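/- Let $n\ge 1$, $\lambda\ge 1$, $0<c\le 1$ and $d_\sigma>0$, and let $f:\mathbb{R}^n\to\mathbb{R}$, $f(x)=g(\langle a,x\rangle+b)$, with $g:\mathbb{R}\to\mathbb{R}$ strictly increasing, $a\in\mathbb{R}^n\setminus\{0\}$ and $b\in\mathbb{R}$. Let $\boldsymbol p_0$ and $\boldsymbol\xi_{t,i}$ ($t\in\mathbb{N}$, $1\le i\le\lambda$) be independent random vectors with the standard normal distribution $\mathcal N(0,I_n)$. The $(1,\lambda)$-CSA-ES minimizing $f$, started at an arbitrary (possibly random) $\boldsymbol X_0\in\mathbb{R}^n$ and $\sigma_0>0$, is the process $(\boldsymbol X_t,\sigma_t,\boldsymbol p_t)_{t\in\mathbb{N}}$ defined by $$\boldsymbol X_{t+1}=\boldsymbol X_t+\sigma_t\boldsymbol\xi_t^\star,\qquad \boldsymbol p_{t+1}=(1-c)\boldsymbol p_t+\sqrt{c(2-c)}\,\boldsymbol\xi^\star_t,\qquad \sigma_{t+1}=\sigma_t\exp\left(\frac{c}{2d_\sigma}\left(\frac{\|\boldsymbol p_{t+1}\|^2}{n}-1\right)\right),$$ where $\boldsymbol\xi^\star_t=\boldsymbol\xi_{t,i}$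 for an index $i$ that minimizes $f(\boldsymbol X_t+\sigma_t\boldsymbol\xi_{t,i})$ (ties, which have probability zero, being broken by any fixed rule that depends on the $\lambda$ objective values). Let $\mathcal N_{1:\lambda}$ be the smallest of $\lambda$ independent standard normal random variables. **Theorem.** Put $$r=\frac{1}{2d_\sigma n}\left(2(1-c)\,\mathbb{E}(\mathcal N_{1:\lambda})^2+c\left(\mathbb{E}(\mathcal N_{1:\lambda}^2)-1\right)\right).$$ Then $\frac1t\ln(\sigma_t/\sigma_0)\to r$ almost surely as $t\to\infty$; moreover $\frac1t\ln(\sigma_t/\sigma_0)$ is integrable for every $t\geq 1$, and $\mathbb{E}\left(\frac1t\ln(\sigma_t/\sigma_0)\right)\to r$. If $\lambda\ge 3$, or if $\lambda=2$ and $c<1$, then $r>0$; hence in these cases the step-size almost surely diverges geometrically, that is, $\frac1t\ln(\sigma_t/\sigma_0)$ converges to a positive constant. -/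

import Mathlib

open MeasureTheory ProbabilityTheory Filter Topology

noncomputable section

namespace CSAES

/-- State `(X_t, σ_t, p_t)` of the algorithm: parent, step-size, cumulative path. -/
structure State (n : ℕ) where
  parent : EuclideanSpace ℝ (Fin n)
  stepSize : ℝ
  path : EuclideanSpace ℝ (Fin n)

/-- A selection rule: given the objective values of the `lam` children it returns the index of
one with the lowest value (ties may be broken in any way). -/
def IsArgmin {lam : ℕ} (select : (Fin lam → ℝ) → Fin lam) : Prop :=
  ∀ (v : Fin lam → ℝ) (j : Fin lam), v (select v) ≤ v j

variable {n lam : ℕ}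

/-- The selected step: the random step `ξ i` of the best child `X + σ ξ i`. -/
def selectedStep (f : EuclideanSpace ℝ (Fin n) → ℝ) (select : (Fin lam → ℝ) → Fin lam)
    (s : State n) (ξ : Fin lam → EuclideanSpace ℝ (Fin n)) : EuclideanSpace ℝ (Fin n) :=
  ξ (select fun i => f (s.parent + s.stepSize • ξ i))

/-- The update `p' = (1 - c) p + √(c (2 - c)) ξ⋆` of the cumulative path. -/
def pathUpdate (c : ℝ) (p ξstar : EuclideanSpace ℝ (Fin n)) : EuclideanSpace ℝ (Fin n) :=
  (1 - c) • p + Real.sqrt (c * (2 - c)) • ξstar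

/-- The step-size change `exp (c / (2 d) (‖p‖² / n - 1))`. -/
def stepSizeChange (c d : ℝ) (p : EuclideanSpace ℝ (Fin n)) : ℝ :=
  Real.exp (c / (2 * d) * (‖p‖ ^ 2 / n - 1))

/-- One iteration of the `(1, lam)`-CSA-ES minimizing `f`, with cumulation parameter `c`
and damping `d`, from the random steps `ξ 1, …, ξ lam`. -/
def step (f : EuclideanSpace ℝ (Fin n) → ℝ) (select : (Fin lam → ℝ) → Fin lam) (c d : ℝ)
    (s : State n) (ξ : Fin lam → EuclideanSpace ℝ (Fin n)) : State n where
  parent := s.parent + s.stepSize • selectedStep f select s ξ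
  stepSize := s.stepSize * stepSizeChange c d (pathUpdate c s.path (selectedStep f select s ξ))
  path := pathUpdate c s.path (selectedStep f select s ξ)

/-- The state after `t` iterations, from the initial state `s₀` and the random steps
`ξ t i` (iteration `t`, child `i`). -/
def run (f : EuclideanSpace ℝ (Fin n) → ℝ) (select : (Fin lam → ℝ) → Fin lam) (c d : ℝ)
    (s₀ : State n) (ξ : ℕ → Fin lam → EuclideanSpace ℝ (Fin n)) : ℕ → State n
  | 0 => s₀
  | t + 1 => step f select c d (run f select c d s₀ ξ t) (ξ t)

/-- The law of `N_{1:lam}`, the smallest of `lam` independent standard normal variables. -/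
def minNormalLaw (lam : ℕ) : Measure ℝ :=
  (Measure.pi fun _ : Fin lam => gaussianReal 0 1).map fun v => ⨅ i, v i

/-- The rate `(2 (1 - c) E(N_{1:lam})² + c (E(N_{1:lam}²) - 1)) / (2 d n)`. -/
def rate (n lam : ℕ) (c d : ℝ) : ℝ :=
  1 / (2 * d * n) *
    (2 * (1 - c) * (∫ x, x ∂minNormalLaw lam) ^ 2 + c * ((∫ x, x ^ 2 ∂minNormalLaw lam) - 1))

/-- A sequence of positive reals diverges geometrically: `(1 / t) ln (s t / s 0)` converges to a
positive constant. -/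
def GeometricallyDivergent (s : ℕ → ℝ) : Prop :=
  ∃ r : ℝ, 0 < r ∧ Tendsto (fun t : ℕ => 1 / (t : ℝ) * Real.log (s t / s 0)) atTop (𝓝 r)

end CSAES

end

/-!
The order of the objective values of the children is the order of the components of their steps in
the direction `u = a / ‖a‖`, and almost surely there are no ties. So the selected steps do not
depend on the parent, the step-size or the tie-breaking rule: they are independent and identically
distributed, with component `N_{1:λ}` along `u` and an unbiased standard normal component orthogonal
to `u`. Hence the cumulative path is a stable autoregressive sequence `p_{t+1} = q p_t + κ y_t`
with independent innovations, and `ln (σ_t / σ_0) / t` is an affine function of the Cesàro mean of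
`‖p‖²`.

Expanding the square, `‖p_{t+1}‖² = q² ‖p_t‖² + 2 q κ ⟨p_t, y_t⟩ + κ² ‖y_t‖²`. The Cesàro means of
the last two terms converge almost surely, by the strong law of large numbers for `y` and `‖y‖²`
and because `⟨p, y - E y⟩` is a martingale difference sequence bounded in `L²`. The contraction by
`q²` passes this on to `‖p‖²`. The limit is positive since `E N_{1:λ} < 0` for `λ ≥ 2`, while a
comparison of tails gives `E N_{1:λ}² ≥ 1`, with strict inequality for `λ ≥ 3`.
-/

noncomputable section

namespace CSAES

section CesaroMean

variable {E : Type*} [NormedAddCommGroup E] [NormedSpace ℝ E]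

/-- The Cesàro mean `(u 0 + ⋯ + u (T - 1)) / T` of the first `T` terms of a sequence; the mean of
no terms is `0`. -/
def cesaroMean (u : ℕ → E) (T : ℕ) : E :=
  (T : ℝ)⁻¹ • ∑ t ∈ Finset.range T, u t

theorem natCast_smul_cesaroMean (u : ℕ → E) (T : ℕ) :
    (T : ℝ) • cesaroMean u T = ∑ t ∈ Finset.range T, u t := by
  rcases eq_or_ne T 0 with rfl | hT
  · simp
  · rw [cesaroMean, smul_inv_smul₀ (by exact_mod_cast hT)]

theorem cesaroMean_add (u v : ℕ → E) (T : ℕ) :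
    cesaroMean (fun t => u t + v t) T = cesaroMean u T + cesaroMean v T := by
  simp only [cesaroMean, Finset.sum_add_distrib, smul_add]

theorem map_cesaroMean {F : Type*} [NormedAddCommGroup F] [NormedSpace ℝ F] (L : E →L[ℝ] F)
    (u : ℕ → E) (T : ℕ) : L (cesaroMean u T) = cesaroMean (fun t => L (u t)) T := by
  simp only [cesaroMean, map_smul, map_sum]

theorem tendsto_cesaroMean_const (l : E) : Tendsto (cesaroMean fun _ => l) atTop (𝓝 l) :=
  tendsto_const_nhds.cesaro_smul

theorem tendsto_cesaroMean_succ {u : ℕ → E} {l : E} (h : Tendsto (cesaroMean u) atTop (𝓝 l)) :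
    Tendsto (cesaroMean fun t => u (t + 1)) atTop (𝓝 l) := by
  have hsucc := h.comp (tendsto_add_atTop_nat 1)
  have hshift : (fun T : ℕ => cesaroMean u (T + 1) + (T : ℝ)⁻¹ • (cesaroMean u (T + 1) - u 0))
      =ᶠ[atTop] cesaroMean fun t => u (t + 1) := by
    filter_upwards [eventually_ne_atTop 0] with T hT
    have hT' : (T : ℝ) ≠ 0 := by exact_mod_cast hT
    have hsum := natCast_smul_cesaroMean u (T + 1)
    rw [Finset.sum_range_succ', ← natCast_smul_cesaroMean fun t => u (t + 1)] at hsum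
    rw [← smul_right_inj hT', smul_add, smul_inv_smul₀ hT',
      eq_sub_of_add_eq hsum.symm]
    push_cast
    module
  simpa using (hsucc.add
    ((tendsto_inv_atTop_nhds_zero_nat (𝕜 := ℝ)).smul (hsucc.sub_const (u 0)))).congr' hshift

theorem tendsto_zero_of_le_mul_add {r e : ℕ → ℝ} {q : ℝ} (hq0 : 0 ≤ q) (hq1 : q < 1)
    (hr : ∀ t, 0 ≤ r t) (hrec : ∀ t, r (t + 1) ≤ q * r t + e t)
    (he : Tendsto e atTop (𝓝 0)) : Tendsto r atTop (𝓝 0) := by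
  have unroll (N k : ℕ) (δ : ℝ) (hδ : ∀ t ≥ N, e t ≤ (1 - q) * δ) :
      r (N + k) - δ ≤ q ^ k * (r N - δ) := by
    induction k with
    | zero => simp
    | succ k ih =>
      rw [← add_assoc, pow_succ']
      linarith [hrec (N + k), hδ (N + k) (Nat.le_add_right N k),
        mul_le_mul_of_nonneg_left ih hq0]
  refine tendsto_order.2 ⟨fun b hb => .of_forall fun t => hb.trans_le (hr t), fun ε hε => ?_⟩
  have herr : ∀ᶠ t in atTop, e t < (1 - q) * (ε / 2) :=
    he.eventually_lt_const (mul_pos (sub_pos.2 hq1) (half_pos hε))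
  obtain ⟨N, hN⟩ := eventually_atTop.1 herr
  have hpow : Tendsto (fun k => q ^ k * (r N - ε / 2)) atTop (𝓝 0) := by
    simpa using (tendsto_pow_atTop_nhds_zero_of_lt_one hq0 hq1).mul_const (r N - ε / 2)
  rw [← map_add_atTop_eq_nat N, eventually_map]
  filter_upwards [hpow.eventually_lt_const (half_pos hε)] with k hk
  rw [add_comm]
  linarith [unroll N k (ε / 2) fun t ht => (hN t ht).le]

theorem tendsto_of_smul_add_recurrence {q : ℝ} (hq : |q| < 1) {x e : ℕ → E} {l e' : E}
    (hx : ∀ t, x (t + 1) = q • x t + e t) (hl : l = q • l + e')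
    (he : Tendsto e atTop (𝓝 e')) : Tendsto x atTop (𝓝 l) := by
  rw [tendsto_iff_norm_sub_tendsto_zero] at he ⊢
  refine tendsto_zero_of_le_mul_add (abs_nonneg q) hq (fun t => norm_nonneg _) (fun t => ?_) he
  calc ‖x (t + 1) - l‖ = ‖q • (x t - l) + (e t - e')‖ := by
        rw [hx, eq_sub_of_add_eq' hl.symm]; congr 1; module
    _ ≤ |q| * ‖x t - l‖ + ‖e t - e'‖ := by
        simpa only [norm_smul, Real.norm_eq_abs] using norm_add_le (q • (x t - l)) (e t - e')

theorem tendsto_cesaroMean_of_smul_add_recurrence {q : ℝ} (hq : |q| < 1) {x e : ℕ → E} {l e' : E}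
    (hx : ∀ t, x (t + 1) = q • x t + e t) (hl : l = q • l + e')
    (he : Tendsto (cesaroMean e) atTop (𝓝 e')) : Tendsto (cesaroMean x) atTop (𝓝 l) := by
  have hsum (T : ℕ) : ∑ t ∈ Finset.range (T + 1), x t =
      q • ∑ t ∈ Finset.range T, x t + (∑ t ∈ Finset.range T, e t + x 0) := by
    simp only [Finset.sum_range_succ', hx, Finset.sum_add_distrib, Finset.smul_sum, add_assoc]
  have hmean (T : ℕ) : ((T + 1 : ℕ) : ℝ) • (cesaroMean x (T + 1) - l) =
      (T : ℝ) • (q • (cesaroMean x T - l) + (cesaroMean e T - e')) + (x 0 - l) := by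
    simp only [smul_sub, smul_add, smul_comm (T : ℝ) q, natCast_smul_cesaroMean, hsum]
    rw [eq_sub_of_add_eq' hl.symm]
    push_cast
    module
  have hbound (T : ℕ) : ‖cesaroMean x (T + 1) - l‖ ≤
      |q| * ‖cesaroMean x T - l‖ + (‖cesaroMean e T - e'‖ + ‖x 0 - l‖ / (T + 1)) := by
    have hT : (0 : ℝ) < ((T + 1 : ℕ) : ℝ) := by positivity
    refine le_of_mul_le_mul_left ?_ hT
    calc ((T + 1 : ℕ) : ℝ) * ‖cesaroMean x (T + 1) - l‖
        = ‖(T : ℝ) • (q • (cesaroMean x T - l) + (cesaroMean e T - e')) + (x 0 - l)‖ := by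
          rw [← hmean, norm_smul, Real.norm_of_nonneg hT.le]
      _ ≤ T * (|q| * ‖cesaroMean x T - l‖ + ‖cesaroMean e T - e'‖) + ‖x 0 - l‖ := by
          refine norm_add_le_of_le ?_ le_rfl
          rw [norm_smul, Real.norm_of_nonneg T.cast_nonneg, ← Real.norm_eq_abs, ← norm_smul]
          gcongr
          exact norm_add_le _ _
      _ ≤ ((T + 1 : ℕ) : ℝ) * (|q| * ‖cesaroMean x T - l‖ + ‖cesaroMean e T - e'‖) +
            ‖x 0 - l‖ := by
          gcongr
          exact T.le_succ
      _ = ((T + 1 : ℕ) : ℝ) * (|q| * ‖cesaroMean x T - l‖ +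
            (‖cesaroMean e T - e'‖ + ‖x 0 - l‖ / (T + 1))) := by
          push_cast
          field_simp
          ring
  rw [tendsto_iff_norm_sub_tendsto_zero] at he ⊢
  refine tendsto_zero_of_le_mul_add (abs_nonneg q) hq (fun T => norm_nonneg _) hbound ?_
  simpa using he.add (tendsto_const_div_atTop_nhds_zero_nat _ |>.comp (tendsto_add_atTop_nat 1))

theorem tendsto_cesaroMean_zero_of_tendsto_sum_inv_smul {a : ℕ → E} {l : E}
    (h : Tendsto (fun n => ∑ k ∈ Finset.range n, ((k : ℝ) + 1)⁻¹ • a k) atTop (𝓝 l)) :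
    Tendsto (cesaroMean a) atTop (𝓝 0) := by
  set s : ℕ → E := fun n => ∑ k ∈ Finset.range n, ((k : ℝ) + 1)⁻¹ • a k
  have abel (n : ℕ) : ∑ k ∈ Finset.range n, a k = (n : ℝ) • s n - ∑ k ∈ Finset.range n, s k := by
    induction n with
    | zero => simp
    | succ n ih =>
      have hstep : s (n + 1) = s n + ((n : ℝ) + 1)⁻¹ • a n := Finset.sum_range_succ _ n
      rw [Finset.sum_range_succ, Finset.sum_range_succ, ih, hstep, smul_add, Nat.cast_succ,
        smul_inv_smul₀ (by positivity)]
      module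
  have hmean : (fun n => s n - cesaroMean s n) =ᶠ[atTop] cesaroMean a := by
    filter_upwards [eventually_ne_atTop 0] with n hn
    rw [cesaroMean, cesaroMean, abel, smul_sub, inv_smul_smul₀ (by exact_mod_cast hn)]
  simpa using (h.sub h.cesaro_smul).congr' hmean

end CesaroMean

section MartingaleDifference

variable {Ω : Type*} {m0 : MeasurableSpace Ω} {P : Measure Ω} {ℱ : Filtration ℕ m0}
  {D : ℕ → Ω → ℝ}

/-- A square-integrable martingale difference sequence, indexed so that `D t` is the increment
from time `t` to time `t + 1`. -/
structure IsMartingaleDifference (D : ℕ → Ω → ℝ) (ℱ : Filtration ℕ m0) (P : Measure Ω) :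
    Prop where
  stronglyMeasurable : ∀ t, StronglyMeasurable[ℱ (t + 1)] (D t)
  memLp : ∀ t, MemLp (D t) 2 P
  condExp_eq_zero : ∀ t, P[D t | ℱ t] =ᵐ[P] 0

namespace IsMartingaleDifference

theorem const_mul (hD : IsMartingaleDifference D ℱ P) (w : ℕ → ℝ) :
    IsMartingaleDifference (fun t ω => w t * D t ω) ℱ P where
  stronglyMeasurable t := (hD.stronglyMeasurable t).const_mul (w t)
  memLp t := (hD.memLp t).const_mul (w t)
  condExp_eq_zero t := by
    filter_upwards [condExp_smul (w t) (D t) (ℱ t), hD.condExp_eq_zero t] with ω hsmul hzero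
    exact hsmul.trans (by simp [hzero])

theorem stronglyMeasurable_sum (hD : IsMartingaleDifference D ℱ P) (n : ℕ) :
    StronglyMeasurable[ℱ n] fun ω => ∑ k ∈ Finset.range n, D k ω :=
  Finset.stronglyMeasurable_fun_sum _ fun k hk =>
    (hD.stronglyMeasurable k).mono (ℱ.mono (Finset.mem_range.1 hk))

theorem memLp_sum (hD : IsMartingaleDifference D ℱ P) (n : ℕ) :
    MemLp (fun ω => ∑ k ∈ Finset.range n, D k ω) 2 P :=
  memLp_finsetSum _ fun k _ => hD.memLp k

variable [IsProbabilityMeasure P]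

theorem martingale_sum (hD : IsMartingaleDifference D ℱ P) :
    Martingale (fun n ω => ∑ k ∈ Finset.range n, D k ω) ℱ P := by
  refine martingale_of_condExp_sub_eq_zero_nat hD.stronglyMeasurable_sum
    (fun n => (hD.memLp_sum n).integrable one_le_two) fun n => ?_
  convert hD.condExp_eq_zero n using 2
  ext ω
  simp [Finset.sum_range_succ]

theorem integral_mul_eq_zero (hD : IsMartingaleDifference D ℱ P) {n : ℕ} {X : Ω → ℝ}
    (hX : StronglyMeasurable[ℱ n] X) (hX2 : MemLp X 2 P) : ∫ ω, X ω * D n ω ∂P = 0 := by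
  have hXD : Integrable (fun ω => X ω * D n ω) P := hX2.integrable_mul (hD.memLp n)
  have hpull : P[fun ω => X ω * D n ω | ℱ n] =ᵐ[P] 0 := by
    filter_upwards [condExp_mul_of_stronglyMeasurable_left hX hXD
      ((hD.memLp n).integrable one_le_two), hD.condExp_eq_zero n] with ω hmul hzero
    exact hmul.trans (by simp [hzero])
  rw [← integral_condExp (ℱ.le n), integral_congr_ae hpull]
  simp

theorem integral_sum_sq (hD : IsMartingaleDifference D ℱ P) (n : ℕ) :
    ∫ ω, (∑ k ∈ Finset.range n, D k ω) ^ 2 ∂P = ∑ k ∈ Finset.range n, ∫ ω, D k ω ^ 2 ∂P := by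
  induction n with
  | zero => simp
  | succ n ih =>
    have hcross : Integrable (fun ω => (∑ k ∈ Finset.range n, D k ω) * D n ω) P :=
      (hD.memLp_sum n).integrable_mul (hD.memLp n)
    have hsum : Integrable (fun ω => (∑ k ∈ Finset.range n, D k ω) ^ 2 +
        2 * ((∑ k ∈ Finset.range n, D k ω) * D n ω)) P :=
      (hD.memLp_sum n).integrable_sq.add (hcross.const_mul 2)
    calc ∫ ω, (∑ k ∈ Finset.range (n + 1), D k ω) ^ 2 ∂P
        = ∫ ω, ((∑ k ∈ Finset.range n, D k ω) ^ 2 +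
            2 * ((∑ k ∈ Finset.range n, D k ω) * D n ω) + D n ω ^ 2) ∂P := by
          simp only [Finset.sum_range_succ, add_sq, mul_assoc]
      _ = ∑ k ∈ Finset.range (n + 1), ∫ ω, D k ω ^ 2 ∂P := by
          rw [integral_add hsum (hD.memLp n).integrable_sq,
            integral_add (hD.memLp_sum n).integrable_sq (hcross.const_mul 2),
            integral_const_mul, ih,
            hD.integral_mul_eq_zero (hD.stronglyMeasurable_sum n) (hD.memLp_sum n),
            Finset.sum_range_succ]
          ring

theorem ae_exists_tendsto_sum (hD : IsMartingaleDifference D ℱ P)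
    (hsum : Summable fun k => ∫ ω, D k ω ^ 2 ∂P) :
    ∀ᵐ ω ∂P, ∃ l, Tendsto (fun n => ∑ k ∈ Finset.range n, D k ω) atTop (𝓝 l) := by
  set C := ∑' k, ∫ ω, D k ω ^ 2 ∂P
  refine hD.martingale_sum.submartingale.exists_ae_tendsto_of_bdd (R := (√C).toNNReal)
    fun n => ?_
  have hvar : ∫ ω, (∑ k ∈ Finset.range n, D k ω) ^ 2 ∂P ≤ C := by
    rw [hD.integral_sum_sq]
    exact hsum.sum_le_tsum _ fun k _ => integral_nonneg fun ω => sq_nonneg _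
  calc eLpNorm (fun ω => ∑ k ∈ Finset.range n, D k ω) 1 P
      ≤ eLpNorm (fun ω => ∑ k ∈ Finset.range n, D k ω) 2 P :=
        eLpNorm_le_eLpNorm_of_exponent_le one_le_two (hD.memLp_sum n).1
    _ ≤ ((√C).toNNReal : ENNReal) := by
        rw [(hD.memLp_sum n).eLpNorm_eq_integral_rpow_norm two_ne_zero ENNReal.ofNat_ne_top]
        refine ENNReal.ofReal_le_ofReal ?_
        simpa [Real.sqrt_eq_rpow] using Real.sqrt_le_sqrt hvar

theorem ae_tendsto_cesaroMean_zero (hD : IsMartingaleDifference D ℱ P)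
    (hbdd : BddAbove (Set.range fun t => ∫ ω, D t ω ^ 2 ∂P)) :
    ∀ᵐ ω ∂P, Tendsto (cesaroMean fun t => D t ω) atTop (𝓝 0) := by
  obtain ⟨C, hC⟩ := hbdd
  have hsum : Summable fun k : ℕ => ∫ ω, (((k : ℝ) + 1)⁻¹ * D k ω) ^ 2 ∂P := by
    have hinv : Summable fun k : ℕ => (((k : ℝ) + 1)⁻¹) ^ 2 * C := by
      simpa using ((summable_nat_add_iff 1).2
        (Real.summable_nat_pow_inv.2 one_lt_two)).mul_right C
    refine hinv.of_nonneg_of_le (fun k => integral_nonneg fun ω => sq_nonneg _) fun k => ?_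
    simp only [mul_pow, integral_const_mul]
    gcongr
    exact hC ⟨k, rfl⟩
  filter_upwards [(hD.const_mul fun k => ((k : ℝ) + 1)⁻¹).ae_exists_tendsto_sum hsum]
    with ω ⟨l, hl⟩
  exact tendsto_cesaroMean_zero_of_tendsto_sum_inv_smul hl

end IsMartingaleDifference

end MartingaleDifference

section Autoregressive

variable {E : Type*} {q κ : ℝ}

/-- The first-order autoregressive sequence `x (t + 1) = q x t + κ y (t + 1)` driven by
`y 1, y 2, …` and started at `x 0 = y 0`. -/
def autoregressive [AddCommGroup E] [Module ℝ E] (q κ : ℝ) (y : ℕ → E) : ℕ → E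
  | 0 => y 0
  | t + 1 => q • autoregressive q κ y t + κ • y (t + 1)

/-- The limit of the second moments of a stable autoregressive sequence whose innovations have
mean `m` and second moment `V`. -/
def autoregressiveSqNormLimit [Norm E] (q κ : ℝ) (m : E) (V : ℝ) : ℝ :=
  κ ^ 2 / (1 - q ^ 2) * (2 * q / (1 - q) * ‖m‖ ^ 2 + V)

theorem abs_sq_lt_one (hq : |q| < 1) : |q ^ 2| < 1 := by
  rwa [abs_pow, sq_abs, sq_lt_one_iff_abs_lt_one]

section NormedSpace

variable [NormedAddCommGroup E] [NormedSpace ℝ E]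

theorem autoregressiveMean_fixedPoint (hq : |q| < 1) (m : E) :
    (κ / (1 - q)) • m = q • (κ / (1 - q)) • m + κ • m := by
  have hq1 : 1 - q ≠ 0 := (sub_pos.2 (abs_lt.1 hq).2).ne'
  rw [smul_smul, ← add_smul]
  congr 1
  field_simp
  ring

theorem tendsto_cesaroMean_autoregressive (hq : |q| < 1) {y : ℕ → E} {m : E}
    (hy : Tendsto (cesaroMean fun t => y (t + 1)) atTop (𝓝 m)) :
    Tendsto (cesaroMean (autoregressive q κ y)) atTop (𝓝 ((κ / (1 - q)) • m)) := by
  refine tendsto_cesaroMean_of_smul_add_recurrence hq (fun t => rfl)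
    (autoregressiveMean_fixedPoint hq m) ?_
  exact (hy.const_smul κ).congr fun T =>
    map_cesaroMean (κ • ContinuousLinearMap.id ℝ E) (fun t => y (t + 1)) T

end NormedSpace

variable [NormedAddCommGroup E] [InnerProductSpace ℝ E]

theorem norm_sq_autoregressive_succ (y : ℕ → E) (t : ℕ) :
    ‖autoregressive q κ y (t + 1)‖ ^ 2 = q ^ 2 * ‖autoregressive q κ y t‖ ^ 2 +
      (2 * q * κ * inner ℝ (autoregressive q κ y t) (y (t + 1)) + κ ^ 2 * ‖y (t + 1)‖ ^ 2) := by
  rw [autoregressive, norm_add_sq_real, inner_smul_left, inner_smul_right, norm_smul, norm_smul,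
    mul_pow, mul_pow, Real.norm_eq_abs, Real.norm_eq_abs, sq_abs, sq_abs]
  simp only [conj_trivial]
  ring

theorem autoregressiveSqNormLimit_fixedPoint (hq : |q| < 1) (m : E) (V : ℝ) :
    autoregressiveSqNormLimit q κ m V = q ^ 2 * autoregressiveSqNormLimit q κ m V +
      (2 * q * κ * inner ℝ ((κ / (1 - q)) • m) m + κ ^ 2 * V) := by
  have hq1 : 1 - q ≠ 0 := (sub_pos.2 (abs_lt.1 hq).2).ne'
  have hq2 : 1 - q ^ 2 ≠ 0 := (sub_pos.2 ((sq_lt_one_iff_abs_lt_one q).2 hq)).ne'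
  rw [autoregressiveSqNormLimit, real_inner_smul_left, real_inner_self_eq_norm_sq]
  field_simp
  ring

theorem tendsto_cesaroMean_norm_sq_autoregressive (hq : |q| < 1) {y : ℕ → E} {m : E} {V : ℝ}
    (hy : Tendsto (cesaroMean fun t => y (t + 1)) atTop (𝓝 m))
    (hV : Tendsto (cesaroMean fun t => ‖y (t + 1)‖ ^ 2) atTop (𝓝 V))
    (hmart : Tendsto (cesaroMean fun t => inner ℝ (autoregressive q κ y t) (y (t + 1) - m))
      atTop (𝓝 0)) :
    Tendsto (cesaroMean fun t => ‖autoregressive q κ y t‖ ^ 2) atTop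
      (𝓝 (autoregressiveSqNormLimit q κ m V)) := by
  refine tendsto_cesaroMean_of_smul_add_recurrence (abs_sq_lt_one hq)
    (fun t => norm_sq_autoregressive_succ y t) (autoregressiveSqNormLimit_fixedPoint hq m V) ?_
  have hinner : Tendsto (cesaroMean fun t => inner ℝ (autoregressive q κ y t) (y (t + 1))) atTop
      (𝓝 (inner ℝ ((κ / (1 - q)) • m) m)) := by
    have hmean := ((innerSL ℝ m).continuous.tendsto _).comp
      (tendsto_cesaroMean_autoregressive (κ := κ) hq hy)
    rw [real_inner_comm, ← add_zero (inner ℝ m _)]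
    refine (hmean.add hmart).congr fun T => ?_
    rw [Function.comp_apply, map_cesaroMean, ← cesaroMean_add]
    simp [inner_sub_right, real_inner_comm]
  refine ((hinner.const_mul (2 * q * κ)).add (hV.const_mul (κ ^ 2))).congr fun T => ?_
  simp only [cesaroMean, Finset.sum_add_distrib, ← Finset.mul_sum, smul_eq_mul]
  ring

end Autoregressive

section Independence

variable {Ω E : Type*} [NormedAddCommGroup E]

theorem inner_sq_le_norm_sq_mul_norm_sq [InnerProductSpace ℝ E] (x z : E) :
    inner ℝ x z ^ 2 ≤ ‖x‖ ^ 2 * ‖z‖ ^ 2 := by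
  rw [← mul_pow, sq_le_sq, abs_of_nonneg (mul_nonneg (norm_nonneg x) (norm_nonneg z))]
  exact abs_real_inner_le_norm x z

variable [MeasurableSpace Ω] {P : Measure Ω} [MeasurableSpace E] [BorelSpace E] {X Z : Ω → E}

theorem integrable_norm_sq_mul_norm_sq_of_indepFun (h : IndepFun X Z P) (hX : MemLp X 2 P)
    (hZ : MemLp Z 2 P) : Integrable (fun ω => ‖X ω‖ ^ 2 * ‖Z ω‖ ^ 2) P :=
  (h.comp (measurable_norm.pow_const 2) (measurable_norm.pow_const 2)).integrable_mul
    (hX.integrable_norm_pow two_ne_zero) (hZ.integrable_norm_pow two_ne_zero)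

variable [InnerProductSpace ℝ E]

theorem memLp_inner_of_indepFun (h : IndepFun X Z P) (hX : MemLp X 2 P) (hZ : MemLp Z 2 P) :
    MemLp (fun ω => inner ℝ (X ω) (Z ω)) 2 P := by
  have hmeas : AEStronglyMeasurable (fun ω => inner ℝ (X ω) (Z ω)) P := hX.1.inner hZ.1
  refine (memLp_two_iff_integrable_sq hmeas).2 <|
    (integrable_norm_sq_mul_norm_sq_of_indepFun h hX hZ).mono' (hmeas.pow 2)
      (.of_forall fun ω => ?_)
  rw [Real.norm_of_nonneg (sq_nonneg _)]
  exact inner_sq_le_norm_sq_mul_norm_sq _ _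

theorem integral_inner_sq_le_of_indepFun (h : IndepFun X Z P) (hX : MemLp X 2 P)
    (hZ : MemLp Z 2 P) :
    ∫ ω, inner ℝ (X ω) (Z ω) ^ 2 ∂P ≤ (∫ ω, ‖X ω‖ ^ 2 ∂P) * ∫ ω, ‖Z ω‖ ^ 2 ∂P := by
  have hprod : ∫ ω, ‖X ω‖ ^ 2 * ‖Z ω‖ ^ 2 ∂P = (∫ ω, ‖X ω‖ ^ 2 ∂P) * ∫ ω, ‖Z ω‖ ^ 2 ∂P :=
    IndepFun.integral_mul_eq_mul_integral
      (h.comp (measurable_norm.pow_const 2) (measurable_norm.pow_const 2))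
      (hX.1.norm.pow 2) (hZ.1.norm.pow 2)
  rw [← hprod]
  exact integral_mono (memLp_inner_of_indepFun h hX hZ).integrable_sq
    (integrable_norm_sq_mul_norm_sq_of_indepFun h hX hZ)
    fun ω => inner_sq_le_norm_sq_mul_norm_sq _ _

end Independence

section Innovations

variable {Ω E : Type*} [MeasurableSpace Ω] {P : Measure Ω}
  [NormedAddCommGroup E] [MeasurableSpace E]

/-- An independent sequence of square-integrable random vectors, identically distributed from the
index `1` on: an initial value `y 0` followed by the innovations `y 1, y 2, …`. -/
structure IsInnovationSequence (y : ℕ → Ω → E) (P : Measure Ω) : Prop where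
  measurable : ∀ t, Measurable (y t)
  iIndepFun : iIndepFun y P
  identDistrib : ∀ t, IdentDistrib (y (t + 1)) (y 1) P P
  memLp_initial : MemLp (y 0) 2 P
  memLp_innovation : MemLp (y 1) 2 P

namespace IsInnovationSequence

variable {y : ℕ → Ω → E} {q : ℝ} [BorelSpace E]

theorem memLp (hy : IsInnovationSequence y P) (t : ℕ) : MemLp (y t) 2 P := by
  cases t with
  | zero => exact hy.memLp_initial
  | succ t => exact (hy.identDistrib t).memLp_iff.2 hy.memLp_innovation

theorem memLp_autoregressive [NormedSpace ℝ E] (hy : IsInnovationSequence y P) (q κ : ℝ)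
    (t : ℕ) :
    MemLp (fun ω => autoregressive q κ (fun s => y s ω) t) 2 P := by
  induction t with
  | zero => exact hy.memLp_initial
  | succ t ih => exact (ih.const_smul q).add ((hy.memLp (t + 1)).const_smul κ)

theorem tendsto_integral_autoregressive [NormedSpace ℝ E] [CompleteSpace E]
    [IsProbabilityMeasure P] (hy : IsInnovationSequence y P) (hq : |q| < 1) (κ : ℝ) :
    Tendsto (fun t => ∫ ω, autoregressive q κ (fun s => y s ω) t ∂P) atTop
      (𝓝 ((κ / (1 - q)) • ∫ ω, y 1 ω ∂P)) := by
  refine tendsto_of_smul_add_recurrence hq (fun t => ?_) (autoregressiveMean_fixedPoint hq _)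
    tendsto_const_nhds
  have hx := (hy.memLp_autoregressive q κ t).integrable one_le_two
  have hinnov := (hy.memLp (t + 1)).integrable one_le_two
  simp only [autoregressive]
  rw [integral_add (hx.fun_smul q) (hinnov.fun_smul κ), integral_smul, integral_smul,
    (hy.identDistrib t).integral_eq]

variable [SecondCountableTopology E]

/-- The history of an innovation sequence. -/
def history (hy : IsInnovationSequence y P) : Filtration ℕ ‹MeasurableSpace Ω› :=
  Filtration.natural y fun t => (hy.measurable t).stronglyMeasurable

theorem stronglyMeasurable_history (hy : IsInnovationSequence y P) (t : ℕ) :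
    StronglyMeasurable[hy.history t] (y t) :=
  Filtration.stronglyAdapted_natural _ t

theorem indep_comap_history (hy : IsInnovationSequence y P) (t : ℕ) :
    Indep (MeasurableSpace.comap (y (t + 1)) inferInstance) (hy.history t) P :=
  hy.iIndepFun.indep_comap_natural_of_lt (fun t => (hy.measurable t).stronglyMeasurable)
    t.lt_succ_self

section NormedSpace

variable [NormedSpace ℝ E]

theorem stronglyMeasurable_autoregressive (hy : IsInnovationSequence y P) (q κ : ℝ) (t : ℕ) :
    StronglyMeasurable[hy.history t] fun ω => autoregressive q κ (fun s => y s ω) t := by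
  induction t with
  | zero => exact hy.stronglyMeasurable_history 0
  | succ t ih =>
    exact ((ih.mono (hy.history.mono t.le_succ)).const_smul q).add
      ((hy.stronglyMeasurable_history (t + 1)).const_smul κ)

theorem indepFun_autoregressive (hy : IsInnovationSequence y P) (q κ : ℝ) (t : ℕ) :
    IndepFun (fun ω => autoregressive q κ (fun s => y s ω) t) (y (t + 1)) P :=
  (IndepFun_iff_Indep ..).2 <| indep_of_indep_of_le_left (hy.indep_comap_history t).symm
    (hy.stronglyMeasurable_autoregressive q κ t).measurable.comap_le

end NormedSpace

variable [InnerProductSpace ℝ E] [CompleteSpace E] [IsProbabilityMeasure P]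

theorem integral_norm_sq_autoregressive_succ (hy : IsInnovationSequence y P) (q κ : ℝ) (t : ℕ) :
    ∫ ω, ‖autoregressive q κ (fun s => y s ω) (t + 1)‖ ^ 2 ∂P =
      q ^ 2 * ∫ ω, ‖autoregressive q κ (fun s => y s ω) t‖ ^ 2 ∂P +
        (2 * q * κ * inner ℝ (∫ ω, autoregressive q κ (fun s => y s ω) t ∂P) (∫ ω, y 1 ω ∂P) +
          κ ^ 2 * ∫ ω, ‖y 1 ω‖ ^ 2 ∂P) := by
  set x : Ω → E := fun ω => autoregressive q κ (fun s => y s ω) t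
  have hx : MemLp x 2 P := hy.memLp_autoregressive q κ t
  have hind : IndepFun x (y (t + 1)) P := hy.indepFun_autoregressive q κ t
  have hinner : Integrable (fun ω => inner ℝ (x ω) (y (t + 1) ω)) P :=
    (memLp_inner_of_indepFun hind hx (hy.memLp (t + 1))).integrable one_le_two
  have hxsq := hx.integrable_norm_pow two_ne_zero
  have hysq := (hy.memLp (t + 1)).integrable_norm_pow two_ne_zero
  have hforcing : Integrable (fun ω => 2 * q * κ * inner ℝ (x ω) (y (t + 1) ω) +
      κ ^ 2 * ‖y (t + 1) ω‖ ^ 2) P := (hinner.const_mul _).add (hysq.const_mul _)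
  have hprod : ∫ ω, inner ℝ (x ω) (y (t + 1) ω) ∂P =
      inner ℝ (∫ ω, x ω ∂P) (∫ ω, y (t + 1) ω ∂P) :=
    hind.integral_bilin (hx.integrable one_le_two) ((hy.memLp (t + 1)).integrable one_le_two)
      (innerSL ℝ)
  have hmean : ∫ ω, y (t + 1) ω ∂P = ∫ ω, y 1 ω ∂P := (hy.identDistrib t).integral_eq
  have hsq : ∫ ω, ‖y (t + 1) ω‖ ^ 2 ∂P = ∫ ω, ‖y 1 ω‖ ^ 2 ∂P :=
    ((hy.identDistrib t).comp (measurable_norm.pow_const 2)).integral_eq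
  simp only [norm_sq_autoregressive_succ]
  rw [integral_add (hxsq.const_mul _) hforcing,
    integral_add (hinner.const_mul _) (hysq.const_mul _), integral_const_mul, integral_const_mul,
    integral_const_mul, hprod, hmean, hsq]

theorem tendsto_integral_norm_sq_autoregressive (hy : IsInnovationSequence y P) (hq : |q| < 1)
    (κ : ℝ) : Tendsto (fun t => ∫ ω, ‖autoregressive q κ (fun s => y s ω) t‖ ^ 2 ∂P) atTop
      (𝓝 (autoregressiveSqNormLimit q κ (∫ ω, y 1 ω ∂P) (∫ ω, ‖y 1 ω‖ ^ 2 ∂P))) :=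
  tendsto_of_smul_add_recurrence (abs_sq_lt_one hq) (hy.integral_norm_sq_autoregressive_succ q κ)
    (autoregressiveSqNormLimit_fixedPoint hq _ _)
    ((((hy.tendsto_integral_autoregressive hq κ).inner tendsto_const_nhds).const_mul _).add_const _)

theorem isMartingaleDifference_inner (hy : IsInnovationSequence y P) (q κ : ℝ) :
    IsMartingaleDifference (fun t ω => inner ℝ (autoregressive q κ (fun s => y s ω) t)
      (y (t + 1) ω - ∫ ω, y 1 ω ∂P)) hy.history P := by
  have hcentered (t : ℕ) : MemLp (fun ω => y (t + 1) ω - ∫ ω, y 1 ω ∂P) 2 P :=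
    (hy.memLp (t + 1)).sub (memLp_const _)
  have hLp (t : ℕ) : MemLp (fun ω => inner ℝ (autoregressive q κ (fun s => y s ω) t)
      (y (t + 1) ω - ∫ ω, y 1 ω ∂P)) 2 P :=
    memLp_inner_of_indepFun ((hy.indepFun_autoregressive q κ t).comp measurable_id
      (measurable_id.sub_const _)) (hy.memLp_autoregressive q κ t) (hcentered t)
  refine ⟨fun t => ?_, hLp, fun t => ?_⟩
  · exact ((hy.stronglyMeasurable_autoregressive q κ t).mono (hy.history.mono t.le_succ)).inner
      ((hy.stronglyMeasurable_history (t + 1)).sub stronglyMeasurable_const)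
  · have hpull := condExp_bilin_of_stronglyMeasurable_left (innerSL ℝ)
      (hy.stronglyMeasurable_autoregressive q κ t) ((hLp t).integrable one_le_two)
      ((hcentered t).integrable one_le_two)
    have hmean : P[fun ω => y (t + 1) ω - ∫ ω, y 1 ω ∂P | hy.history t] =ᵐ[P] 0 := by
      refine (condExp_indep_eq (hy.measurable (t + 1)).comap_le (hy.history.le t)
        ((comap_measurable (y (t + 1))).stronglyMeasurable.sub stronglyMeasurable_const)
        (hy.indep_comap_history t)).trans (.of_forall fun ω => ?_)
      simp [integral_sub ((hy.memLp (t + 1)).integrable one_le_two) (integrable_const _),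
        (hy.identDistrib t).integral_eq]
    filter_upwards [hpull, hmean] with ω hpull hmean
    exact hpull.trans (by simp [hmean])

theorem bddAbove_integral_inner_sq (hy : IsInnovationSequence y P) (hq : |q| < 1) (κ : ℝ) :
    BddAbove (Set.range fun t => ∫ ω, inner ℝ (autoregressive q κ (fun s => y s ω) t)
      (y (t + 1) ω - ∫ ω, y 1 ω ∂P) ^ 2 ∂P) := by
  obtain ⟨K, hK⟩ := (hy.tendsto_integral_norm_sq_autoregressive hq κ).bddAbove_range
  refine ⟨K * ∫ ω, ‖y 1 ω - ∫ ω, y 1 ω ∂P‖ ^ 2 ∂P, ?_⟩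
  rintro _ ⟨t, rfl⟩
  have hsub : Measurable fun v : E => v - ∫ ω, y 1 ω ∂P := measurable_id.sub_const _
  have hvar : ∫ ω, ‖y (t + 1) ω - ∫ ω, y 1 ω ∂P‖ ^ 2 ∂P =
      ∫ ω, ‖y 1 ω - ∫ ω, y 1 ω ∂P‖ ^ 2 ∂P :=
    ((hy.identDistrib t).comp (hsub.norm.pow_const 2)).integral_eq
  refine (integral_inner_sq_le_of_indepFun ((hy.indepFun_autoregressive q κ t).comp measurable_id
    hsub) (hy.memLp_autoregressive q κ t) ((hy.memLp (t + 1)).sub (memLp_const _))).trans ?_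
  rw [← hvar]
  exact mul_le_mul_of_nonneg_right (hK ⟨t, rfl⟩) (integral_nonneg fun ω => sq_nonneg _)

theorem ae_tendsto_cesaroMean_norm_sq_autoregressive (hy : IsInnovationSequence y P)
    (hq : |q| < 1) (κ : ℝ) :
    ∀ᵐ ω ∂P, Tendsto (cesaroMean fun t => ‖autoregressive q κ (fun s => y s ω) t‖ ^ 2) atTop
      (𝓝 (autoregressiveSqNormLimit q κ (∫ ω, y 1 ω ∂P) (∫ ω, ‖y 1 ω‖ ^ 2 ∂P))) := by
  have hnorm : Measurable fun v : E => ‖v‖ ^ 2 := measurable_norm.pow_const 2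
  have hmean : ∀ᵐ ω ∂P, Tendsto (cesaroMean fun t => y (t + 1) ω) atTop (𝓝 (∫ ω, y 1 ω ∂P)) :=
    strong_law_ae (fun t => y (t + 1)) (hy.memLp_innovation.integrable one_le_two)
      (fun s t hst => hy.iIndepFun.indepFun (by simpa using hst)) hy.identDistrib
  have hsq : ∀ᵐ ω ∂P, Tendsto (cesaroMean fun t => ‖y (t + 1) ω‖ ^ 2) atTop
      (𝓝 (∫ ω, ‖y 1 ω‖ ^ 2 ∂P)) :=
    strong_law_ae (fun t ω => ‖y (t + 1) ω‖ ^ 2)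
      (hy.memLp_innovation.integrable_norm_pow two_ne_zero)
      (fun s t hst => (hy.iIndepFun.indepFun (by simpa using hst)).comp hnorm hnorm)
      fun t => (hy.identDistrib t).comp hnorm
  filter_upwards [hmean, hsq, (hy.isMartingaleDifference_inner q κ).ae_tendsto_cesaroMean_zero
    (hy.bddAbove_integral_inner_sq hq κ)] with ω hmean hsq hmart
  exact tendsto_cesaroMean_norm_sq_autoregressive hq hmean hsq hmart

end IsInnovationSequence

end Innovations

section OrderStatistics

variable {ι : Type*}

theorem abs_iInf_le_sum_abs [Fintype ι] (v : ι → ℝ) : |⨅ i, v i| ≤ ∑ i, |v i| := by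
  rcases isEmpty_or_nonempty ι with _ | _
  · simp
  · obtain ⟨i, hi⟩ := exists_eq_ciInf_of_finite (f := v)
    rw [← hi]
    exact Finset.single_le_sum (f := fun i => |v i|) (fun j _ => abs_nonneg _) (Finset.mem_univ i)

theorem lt_sq_iInf_iff [Finite ι] [Nonempty ι] (v : ι → ℝ) {t : ℝ} (ht : 0 ≤ t) :
    t < (⨅ i, v i) ^ 2 ↔ (∀ i, √t < v i) ∨ ¬ ∀ i, -√t ≤ v i := by
  have hle (i : ι) : ⨅ i, v i ≤ v i := ciInf_le (Set.finite_range v).bddBelow i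
  obtain ⟨j, hj⟩ := exists_eq_ciInf_of_finite (f := v)
  rw [← Real.sqrt_lt_sqrt_iff ht, Real.sqrt_sq_eq_abs, lt_abs, lt_neg, not_forall]
  simp only [not_le]
  exact or_congr ⟨fun h i => h.trans_le (hle i), fun h => hj ▸ h j⟩
    ⟨fun h => ⟨j, hj ▸ h⟩, fun ⟨i, hi⟩ => (hle i).trans_lt hi⟩

/-- For `k` independent copies of a symmetric random variable `X` with `b = P(X > √t)`, the two
sides are `P(X² > t)` and the probability that the square of the smallest copy exceeds `t`. -/
theorem two_mul_le_pow_add_one_sub_pow {b : ℝ} (hb0 : 0 ≤ b) (hb : b ≤ 1 / 2) {k : ℕ}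
    (hk : 2 ≤ k) : 2 * b ≤ b ^ k + (1 - (1 - b) ^ k) := by
  induction k, hk using Nat.le_induction with
  | base => nlinarith
  | succ k hk ih =>
    obtain ⟨j, rfl⟩ := Nat.exists_eq_add_of_le' (one_le_two.trans hk)
    have hpow : b ^ j ≤ (1 - b) ^ j := pow_le_pow_left₀ hb0 (by linarith) _
    have hgain : 0 ≤ b * (1 - b) * ((1 - b) ^ j - b ^ j) :=
      mul_nonneg (mul_nonneg hb0 (by linarith)) (sub_nonneg.2 hpow)
    calc 2 * b ≤ b ^ (j + 1) + (1 - (1 - b) ^ (j + 1)) + b * (1 - b) * ((1 - b) ^ j - b ^ j) := by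
          linarith
      _ = b ^ (j + 1 + 1) + (1 - (1 - b) ^ (j + 1 + 1)) := by ring

theorem two_mul_lt_pow_add_one_sub_pow {b : ℝ} (hb0 : 0 < b) (hb : b < 1 / 2) {k : ℕ}
    (hk : 3 ≤ k) : 2 * b < b ^ k + (1 - (1 - b) ^ k) := by
  obtain ⟨j, rfl⟩ := Nat.exists_eq_add_of_le' hk
  have hpow : b ^ (j + 1) < (1 - b) ^ (j + 1) := pow_lt_pow_left₀ (by linarith) hb0.le (by omega)
  have hgain : 0 < b * (1 - b) * ((1 - b) ^ (j + 1) - b ^ (j + 1)) :=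
    mul_pos (mul_pos hb0 (by linarith)) (sub_pos.2 hpow)
  calc 2 * b ≤ b ^ (j + 2) + (1 - (1 - b) ^ (j + 2)) :=
        two_mul_le_pow_add_one_sub_pow hb0.le hb.le (by omega)
    _ < b ^ (j + 2) + (1 - (1 - b) ^ (j + 2)) +
        b * (1 - b) * ((1 - b) ^ (j + 1) - b ^ (j + 1)) := lt_add_of_pos_right _ hgain
    _ = b ^ (j + 3) + (1 - (1 - b) ^ (j + 3)) := by ring

theorem measurable_iInf_eval [Countable ι] : Measurable fun v : ι → ℝ => ⨅ i, v i :=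
  Measurable.iInf fun i => measurable_pi_apply i

theorem measureReal_Ioi_pos (μ : Measure ℝ) [IsFiniteMeasure μ] [μ.IsOpenPosMeasure] (s : ℝ) :
    0 < μ.real (Set.Ioi s) :=
  ENNReal.toReal_pos (isOpen_Ioi.measure_pos _ Set.nonempty_Ioi).ne' (measure_ne_top _ _)

theorem measurable_measureReal_Ioi_sqrt (μ : Measure ℝ) [IsFiniteMeasure μ] :
    Measurable fun t : ℝ => μ.real (Set.Ioi √t) :=
  Antitone.measurable fun _ _ hst =>
    measureReal_mono (Set.Ioi_subset_Ioi (Real.sqrt_le_sqrt hst))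

variable [Fintype ι] {μ : Measure ℝ} [IsProbabilityMeasure μ]

theorem memLp_iInf_pi {p : ENNReal} (hμ : MemLp id p μ) :
    MemLp (fun v : ι → ℝ => ⨅ i, v i) p (Measure.pi fun _ : ι => μ) := by
  have heval (i : ι) : MemLp (fun v : ι → ℝ => v i) p (Measure.pi fun _ : ι => μ) :=
    hμ.comp_measurePreserving (measurePreserving_eval (fun _ : ι => μ) i)
  refine (memLp_finsetSum Finset.univ fun i _ => (heval i).abs).mono
    measurable_iInf_eval.aestronglyMeasurable (ae_of_all _ fun v => ?_)
  exact (abs_iInf_le_sum_abs v).trans (le_abs_self _)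

theorem integral_iInf_lt_integral [Nontrivial ι] [μ.IsOpenPosMeasure] (hμ : Integrable id μ) :
    ∫ v, ⨅ i, v i ∂(Measure.pi fun _ : ι => μ) < ∫ x, x ∂μ := by
  obtain ⟨i₀, i₁, hne⟩ := exists_pair_ne ι
  have hle (v : ι → ℝ) (i : ι) : ⨅ i, v i ≤ v i := ciInf_le (Set.finite_range v).bddBelow i
  have hmin : Integrable (fun v : ι → ℝ => ⨅ i, v i) (Measure.pi fun _ => μ) :=
    memLp_one_iff_integrable.1 (memLp_iInf_pi (memLp_one_iff_integrable.2 hμ))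
  have heval : Integrable (fun v : ι → ℝ => v i₀) (Measure.pi fun _ => μ) :=
    integrable_comp_eval (f := id) hμ
  have hpos : 0 < ∫ v, (v i₀ - ⨅ i, v i) ∂(Measure.pi fun _ : ι => μ) := by
    rw [integral_pos_iff_support_of_nonneg (fun v => sub_nonneg.2 (hle v i₀)) (heval.sub hmin)]
    have hopen : IsOpen {v : ι → ℝ | v i₁ < v i₀} :=
      isOpen_lt (continuous_apply i₁) (continuous_apply i₀)
    classical
    refine (hopen.measure_pos _ ⟨Pi.single i₀ 1, by simp [hne.symm]⟩).trans_le
      (measure_mono fun v hv => ?_)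
    exact (sub_pos.2 ((hle v i₁).trans_lt hv)).ne'
  rwa [integral_sub heval hmin, integral_eval, sub_pos] at hpos

section Symmetric

variable [μ.IsNegInvariant]

theorem measureReal_Ici_neg (s : ℝ) : μ.real (Set.Ici (-s)) = 1 - μ.real (Set.Ioi s) := by
  have hsymm : μ.real (Set.Iio (-s)) = μ.real (Set.Ioi s) := by
    rw [measureReal_def, measureReal_def, ← Measure.measure_preimage_neg μ (Set.Ioi s)]
    simp
  rw [← hsymm, ← probReal_compl_eq_one_sub measurableSet_Iio, Set.compl_Iio]

theorem measureReal_Ioi_le_half {s : ℝ} (hs : 0 ≤ s) : μ.real (Set.Ioi s) ≤ 1 / 2 := by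
  have hsubset : μ.real (Set.Ioi s) ≤ μ.real (Set.Ici (-s)) :=
    measureReal_mono (Set.Ioi_subset_Ici (by linarith))
  rw [measureReal_Ici_neg] at hsubset
  linarith

theorem measureReal_Ioi_lt_half [μ.IsOpenPosMeasure] {s : ℝ} (hs : 0 < s) :
    μ.real (Set.Ioi s) < 1 / 2 := by
  have hIoc : 0 < μ.real (Set.Ioc 0 s) :=
    ENNReal.toReal_pos (((isOpen_Ioo.measure_pos μ (Set.nonempty_Ioo.2 hs)).trans_le
      (measure_mono Set.Ioo_subset_Ioc_self)).ne') (measure_ne_top _ _)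
  have hunion : μ.real (Set.Ioi 0) = μ.real (Set.Ioc 0 s) + μ.real (Set.Ioi s) := by
    have hdisj : Disjoint (Set.Ioc 0 s) (Set.Ioi s) :=
      Set.disjoint_left.2 fun x hx => not_lt.2 hx.2
    rw [← measureReal_union hdisj measurableSet_Ioi, Set.Ioc_union_Ioi_eq_Ioi hs.le]
  linarith [measureReal_Ioi_le_half (μ := μ) le_rfl]

theorem measureReal_pi_lt_sq_iInf [Nonempty ι] {t : ℝ} (ht : 0 ≤ t) :
    (Measure.pi fun _ : ι => μ).real {v | t < (⨅ i, v i) ^ 2} =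
      μ.real (Set.Ioi √t) ^ Fintype.card ι +
        (1 - (1 - μ.real (Set.Ioi √t)) ^ Fintype.card ι) := by
  have hset : {v : ι → ℝ | t < (⨅ i, v i) ^ 2} =
      (Set.univ.pi fun _ => Set.Ioi √t) ∪ (Set.univ.pi fun _ => Set.Ici (-√t))ᶜ := by
    ext v
    simp only [Set.mem_ofPred_eq, lt_sq_iInf_iff v ht, Set.mem_union, Set.mem_univ_pi, Set.mem_Ioi,
      Set.mem_compl_iff, Set.mem_Ici]
  have hm : MeasurableSet (Set.univ.pi fun _ : ι => Set.Ici (-√t)) :=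
    MeasurableSet.univ_pi fun _ => measurableSet_Ici
  have hpi (s : Set ℝ) : (Measure.pi fun _ : ι => μ).real (Set.univ.pi fun _ => s) =
      μ.real s ^ Fintype.card ι := by
    simp [measureReal_def, Measure.pi_pi]
  rw [hset, measureReal_union ?_ hm.compl, probReal_compl_eq_one_sub hm, hpi, hpi,
    measureReal_Ici_neg]
  refine Set.disjoint_compl_right_iff_subset.2 (Set.pi_mono fun i _ => Set.Ioi_subset_Ici ?_)
  linarith [Real.sqrt_nonneg t]

theorem ofReal_integral_sq_iInf [Nonempty ι] (hμ : MemLp id 2 μ) :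
    ENNReal.ofReal (∫ v, (⨅ i, v i) ^ 2 ∂(Measure.pi fun _ : ι => μ)) =
      ∫⁻ t in Set.Ioi (0 : ℝ), ENNReal.ofReal (μ.real (Set.Ioi √t) ^ Fintype.card ι +
        (1 - (1 - μ.real (Set.Ioi √t)) ^ Fintype.card ι)) := by
  have hi := (memLp_iInf_pi (ι := ι) hμ).integrable_sq
  have hnn : 0 ≤ᵐ[Measure.pi fun _ : ι => μ] fun v : ι → ℝ => (⨅ i, v i) ^ 2 :=
    ae_of_all _ fun v => sq_nonneg _
  rw [ofReal_integral_eq_lintegral_ofReal hi hnn,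
    lintegral_eq_lintegral_meas_lt _ hnn hi.aemeasurable]
  refine setLIntegral_congr_fun measurableSet_Ioi fun t ht => ?_
  rw [← measureReal_pi_lt_sq_iInf (le_of_lt ht), ofReal_measureReal]

theorem ofReal_integral_sq (hμ : MemLp id 2 μ) :
    ENNReal.ofReal (∫ x, x ^ 2 ∂μ) =
      ∫⁻ t in Set.Ioi (0 : ℝ), ENNReal.ofReal (2 * μ.real (Set.Ioi √t)) := by
  have hone := ofReal_integral_sq_iInf (ι := Unit) hμ
  simp only [ciInf_unique, Fintype.card_unit, pow_one, sub_sub_cancel, ← two_mul] at hone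
  rw [← hone, integral_comp_eval (μ := fun _ : Unit => μ) (f := fun x : ℝ => x ^ 2)
    (by fun_prop)]

theorem integral_sq_le_integral_sq_iInf (hι : 2 ≤ Fintype.card ι) (hμ : MemLp id 2 μ) :
    ∫ x, x ^ 2 ∂μ ≤ ∫ v, (⨅ i, v i) ^ 2 ∂(Measure.pi fun _ : ι => μ) := by
  have : Nonempty ι := Fintype.card_pos_iff.1 (by omega)
  have hmeas := measurable_measureReal_Ioi_sqrt μ
  rw [← ENNReal.ofReal_le_ofReal_iff (integral_nonneg fun v => sq_nonneg _),
    ofReal_integral_sq hμ, ofReal_integral_sq_iInf hμ]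
  exact setLIntegral_mono (by fun_prop) fun t _ => ENNReal.ofReal_le_ofReal
    (two_mul_le_pow_add_one_sub_pow measureReal_nonneg
      (measureReal_Ioi_le_half (Real.sqrt_nonneg t)) hι)

theorem integral_sq_lt_integral_sq_iInf [μ.IsOpenPosMeasure] (hι : 3 ≤ Fintype.card ι)
    (hμ : MemLp id 2 μ) :
    ∫ x, x ^ 2 ∂μ < ∫ v, (⨅ i, v i) ^ 2 ∂(Measure.pi fun _ : ι => μ) := by
  have : Nonempty ι := Fintype.card_pos_iff.1 (by omega)
  have hmeas := measurable_measureReal_Ioi_sqrt μ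
  rw [← ENNReal.ofReal_lt_ofReal_iff_of_nonneg (integral_nonneg fun v => sq_nonneg _),
    ofReal_integral_sq hμ, ofReal_integral_sq_iInf hμ]
  refine setLIntegral_strict_mono measurableSet_Ioi (by simp) (by fun_prop)
    (ofReal_integral_sq hμ ▸ ENNReal.ofReal_ne_top) (ae_of_all _ fun t ht => ?_)
  have hpos := measureReal_Ioi_pos μ √t
  have hlt := two_mul_lt_pow_add_one_sub_pow hpos
    (measureReal_Ioi_lt_half (Real.sqrt_pos.2 ht)) hι
  exact (ENNReal.ofReal_lt_ofReal_iff (by linarith)).2 hlt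

end Symmetric

end OrderStatistics

section Selection

variable {Ω β ι : Type*} [MeasurableSpace Ω] [MeasurableSpace β] {P : Measure Ω}

theorem hasLaw_eval_of_indepFun [Finite ι] [MeasurableSpace ι] [MeasurableSingletonClass ι]
    [IsProbabilityMeasure P] {I : Ω → ι} {W : ι → Ω → β} {ν : Measure β} (hI : Measurable I)
    (hWm : ∀ i, Measurable (W i)) (hW : ∀ i, HasLaw (W i) ν P)
    (hind : ∀ i, IndepFun I (W i) P) :
    HasLaw (fun ω => W (I ω) ω) ν P := by
  have := Fintype.ofFinite ι
  have hm : Measurable fun ω => W (I ω) ω :=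
    (measurable_from_prod_countable_right (f := fun q : ι × Ω => W q.1 q.2) hWm).comp
      (hI.prodMk measurable_id)
  refine ⟨hm.aemeasurable, Measure.ext fun s hs => ?_⟩
  have hfiber (i : ι) : P.restrict ((fun ω => W (I ω) ω) ⁻¹' s) (I ⁻¹' {i}) =
      P (I ⁻¹' {i}) * ν s := by
    rw [Measure.restrict_apply (hI (measurableSet_singleton i)), ← (hW i).map_eq,
      Measure.map_apply (hWm i) hs,
      ← (hind i).measure_inter_preimage_eq_mul _ _ (measurableSet_singleton i) hs]
    congr 1
    ext ω
    simp +contextual [and_congr_right_iff]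
  have hsum (Q : Measure Ω) : ∑ i, Q (I ⁻¹' {i}) = Q Set.univ := by
    rw [sum_measure_preimage_singleton _ fun i _ => hI (measurableSet_singleton i)]
    simp
  calc P.map (fun ω => W (I ω) ω) s
      = P.restrict ((fun ω => W (I ω) ω) ⁻¹' s) Set.univ := by
        rw [Measure.map_apply hm hs, Measure.restrict_apply_univ]
    _ = (∑ i, P (I ⁻¹' {i})) * ν s := by
        rw [← hsum, Finset.sum_congr rfl fun i _ => hfiber i, Finset.sum_mul]
    _ = ν s := by rw [hsum, measure_univ, one_mul]

theorem exists_measurable_argmin (ι : Type*) [Finite ι] [Nonempty ι] [MeasurableSpace ι] :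
    ∃ I : (ι → ℝ) → ι, Measurable I ∧ ∀ (v : ι → ℝ) (j : ι), v (I v) ≤ v j := by
  classical
  obtain ⟨e, he⟩ := exists_injective_nat ι
  let p (v : ι → ℝ) (k : ℕ) : Prop := ∃ i, e i = k ∧ ∀ j, v i ≤ v j
  have hp (v : ι → ℝ) : ∃ k, p v k := by
    obtain ⟨i, hi⟩ := Finite.exists_min v
    exact ⟨e i, i, rfl, hi⟩
  have hmeas (k : ℕ) : MeasurableSet {v | p v k} := by
    simp only [p, Set.ofPred_exists, Set.ofPred_and, Set.ofPred_forall]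
    exact .iUnion fun i => .inter (.const _)
      (.iInter fun j => measurableSet_le (measurable_pi_apply i) (measurable_pi_apply j))
  choose I hI hmin using fun v => Nat.find_spec (hp v)
  refine ⟨I, measurable_to_countable' fun i => ?_, hmin⟩
  have hpreimage : I ⁻¹' {i} = (fun v => Nat.find (hp v)) ⁻¹' {e i} := by
    ext v
    simp [← hI, he.eq_iff]
  rw [hpreimage]
  exact measurable_find hp hmeas (measurableSet_singleton _)

theorem ae_injective_pi [Fintype ι] [MeasurableEq β] (μ : Measure β) [IsProbabilityMeasure μ]
    [NullSingletonClass μ] : ∀ᵐ v ∂(Measure.pi fun _ : ι => μ), Function.Injective v := by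
  have hne (i j : ι) (hij : i ≠ j) : ∀ᵐ v ∂(Measure.pi fun _ : ι => μ), v i ≠ v j := by
    have hlaw : HasLaw (fun v : ι → β => (v i, v j)) (μ.prod μ) (Measure.pi fun _ : ι => μ) := by
      refine (indepFun_iff_hasLaw_prodMk_prod
        (measurePreserving_eval (fun _ : ι => μ) i).hasLaw
        (measurePreserving_eval (fun _ : ι => μ) j).hasLaw).1 ?_
      exact (iIndepFun_pi (μ := fun _ : ι => μ) (X := fun _ => id)
        fun _ => aemeasurable_id).indepFun hij
    have hdiag : μ.prod μ (Set.diagonal β) = 0 := by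
      rw [Measure.measure_prod_null measurableSet_diagonal]
      refine ae_of_all _ fun x => ?_
      have hx : Prod.mk x ⁻¹' Set.diagonal β = {x} := by ext y; simp [eq_comm]
      simp [hx]
    rw [← hlaw.map_eq] at hdiag
    exact ae_of_ae_map hlaw.aemeasurable (compl_mem_ae_iff.2 hdiag)
  have hall : ∀ᵐ v ∂(Measure.pi fun _ : ι => μ), ∀ i j, i ≠ j → v i ≠ v j := by
    simpa only [ae_all_iff] using hne
  filter_upwards [hall] with v hv i j
  exact not_imp_not.1 (hv i j)

end Selection

section StandardGaussian

variable {E : Type*} [NormedAddCommGroup E] [InnerProductSpace ℝ E] [FiniteDimensional ℝ E]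
  [MeasurableSpace E] [BorelSpace E]

theorem hasLaw_inner_stdGaussian {u : E} (hu : ‖u‖ = 1) :
    HasLaw (fun x => inner ℝ u x) (gaussianReal 0 1) (stdGaussian E) := by
  refine ⟨by fun_prop, ?_⟩
  have h := IsGaussian.map_eq_gaussianReal (μ := stdGaussian E) (innerSL ℝ u)
  rw [integral_strongDual_stdGaussian, variance_dual_stdGaussian, innerSL_apply_norm, hu] at h
  simpa using h

theorem integral_inner_sq_stdGaussian {u : E} (hu : ‖u‖ = 1) :
    ∫ x, inner ℝ u x ^ 2 ∂stdGaussian E = 1 := by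
  have h := variance_of_integral_eq_zero (X := innerSL ℝ u) (by fun_prop)
    (integral_strongDual_stdGaussian (E := E) (innerSL ℝ u))
  rw [variance_dual_stdGaussian, innerSL_apply_norm, hu, one_pow] at h
  exact h.symm

theorem integral_norm_sq_stdGaussian :
    ∫ x, ‖x‖ ^ 2 ∂stdGaussian E = Module.finrank ℝ E := by
  have hint (k) : Integrable (fun x => inner ℝ (stdOrthonormalBasis ℝ E k) x ^ 2)
      (stdGaussian E) :=
    (IsGaussian.memLp_two_id.const_inner _).integrable_sq
  simp_rw [← (stdOrthonormalBasis ℝ E).sum_sq_inner_right]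
  rw [integral_finsetSum _ fun k _ => hint k,
    Finset.sum_congr rfl fun k _ =>
      integral_inner_sq_stdGaussian ((stdOrthonormalBasis ℝ E).norm_eq_one k)]
  simp

theorem indepFun_starProjection_stdGaussian (K : Submodule ℝ E) :
    IndepFun K.starProjection Kᗮ.starProjection (stdGaussian E) := by
  have hjoint : HasGaussianLaw (fun x => (K.starProjection x, Kᗮ.starProjection x))
      (stdGaussian E) :=
    IsGaussian.hasGaussianLaw_id.map_fun (K.starProjection.prod Kᗮ.starProjection)
  refine hjoint.indepFun_of_covariance_inner fun x y => ?_
  simp only [← Submodule.inner_starProjection_left_eq_right]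
  rw [← covarianceBilin_apply_eq_cov IsGaussian.memLp_two_id, covarianceBilin_stdGaussian]
  exact Submodule.inner_right_of_mem_orthogonal (K.starProjection_apply_mem x)
    (Kᗮ.starProjection_apply_mem y)

end StandardGaussian

section BestStep

theorem indepFun_pi_of_indepFun {α β γ ι : Type*} [Fintype ι] [MeasurableSpace α]
    [MeasurableSpace β] [MeasurableSpace γ] {μ : Measure α} [IsProbabilityMeasure μ]
    {f : α → β} {g : α → γ} (hf : Measurable f) (hg : Measurable g) (h : IndepFun f g μ) :
    IndepFun (fun (z : ι → α) i => f (z i)) (fun z i => g (z i)) (Measure.pi fun _ => μ) := by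
  have := Measure.isProbabilityMeasure_map hf.aemeasurable (μ := μ)
  have := Measure.isProbabilityMeasure_map hg.aemeasurable (μ := μ)
  have hpair : MeasurePreserving (fun x => (f x, g x)) μ ((μ.map f).prod (μ.map g)) :=
    ⟨hf.prodMk hg, (indepFun_iff_map_prod_eq_prod_map_map hf.aemeasurable hg.aemeasurable).1 h⟩
  rw [indepFun_iff_hasLaw_prodMk_prod
    (measurePreserving_pi _ _ fun _ : ι => hf.measurePreserving μ).hasLaw
    (measurePreserving_pi _ _ fun _ : ι => hg.measurePreserving μ).hasLaw]
  exact ((measurePreserving_arrowProdEquivProdArrow β γ ι (fun _ => μ.map f)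
    (fun _ => μ.map g)).comp (measurePreserving_pi _ _ fun _ : ι => hpair)).hasLaw

variable {E ι : Type*} [NormedAddCommGroup E] [InnerProductSpace ℝ E]

/-- The step selected among `z` by the rule `I`, which only sees the components of the candidate
steps in the direction `u`. -/
def bestStep (I : (ι → ℝ) → ι) (u : E) (z : ι → E) : E :=
  z (I fun j => inner ℝ u (z j))

theorem inner_bestStep [Finite ι] [Nonempty ι] {I : (ι → ℝ) → ι}
    (hmin : ∀ (v : ι → ℝ) (j : ι), v (I v) ≤ v j) (u : E) (z : ι → E) :
    inner ℝ u (bestStep I u z) = ⨅ j, inner ℝ u (z j) :=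
  le_antisymm (le_ciInf fun j => hmin (fun j => inner ℝ u (z j)) j)
    (ciInf_le (Set.finite_range fun j => inner ℝ u (z j)).bddBelow _)

theorem norm_bestStep_le [Fintype ι] (I : (ι → ℝ) → ι) (u : E) (z : ι → E) :
    ‖bestStep I u z‖ ≤ ∑ j, ‖z j‖ :=
  Finset.single_le_sum (f := fun j => ‖z j‖) (fun _ _ => norm_nonneg _) (Finset.mem_univ _)

theorem norm_sq_eq_inner_sq_add_norm_sq_starProjection {u : E} (hu : ‖u‖ = 1) (x : E) :
    ‖x‖ ^ 2 = inner ℝ u x ^ 2 + ‖(ℝ ∙ u)ᗮ.starProjection x‖ ^ 2 := by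
  rw [Submodule.norm_sq_eq_add_norm_sq_starProjection x (ℝ ∙ u),
    Submodule.starProjection_unit_singleton ℝ hu, norm_smul, hu, mul_one, Real.norm_eq_abs, sq_abs]

variable [FiniteDimensional ℝ E] [MeasurableSpace E] [BorelSpace E]

theorem indepFun_inner_starProjection_stdGaussian (u : E) :
    IndepFun (fun x => inner ℝ u x) (ℝ ∙ u)ᗮ.starProjection (stdGaussian E) := by
  have hinner : (fun x => inner ℝ u x) = (fun x => inner ℝ u x) ∘ (ℝ ∙ u).starProjection := by
    ext x
    have hu : (ℝ ∙ u).starProjection u = u :=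
      Submodule.starProjection_eq_self_iff.2 (Submodule.mem_span_singleton_self u)
    simp only [Function.comp_apply, ← Submodule.inner_starProjection_left_eq_right, hu]
  rw [hinner]
  exact (indepFun_starProjection_stdGaussian (ℝ ∙ u)).comp (by fun_prop) measurable_id

variable {I : (ι → ℝ) → ι} {u : E}

theorem measurable_bestStep [Countable ι] [MeasurableSpace ι] [MeasurableSingletonClass ι]
    (hI : Measurable I) (u : E) : Measurable (bestStep I u) :=
  (measurable_from_prod_countable_right (f := fun q : ι × (ι → E) => q.2 q.1)
    fun i => measurable_pi_apply i).comp
    ((hI.comp (by fun_prop : Measurable fun (z : ι → E) j => inner ℝ u (z j))).prodMk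
      measurable_id)

theorem integral_norm_sq_starProjection_orthogonal_stdGaussian (hu : ‖u‖ = 1) :
    ∫ x, ‖(ℝ ∙ u)ᗮ.starProjection x‖ ^ 2 ∂stdGaussian E = Module.finrank ℝ E - 1 := by
  have hinner : Integrable (fun x => inner ℝ u x ^ 2) (stdGaussian E) :=
    (IsGaussian.memLp_two_id.const_inner u).integrable_sq
  have hproj : Integrable (fun x => ‖(ℝ ∙ u)ᗮ.starProjection x‖ ^ 2) (stdGaussian E) :=
    ((ℝ ∙ u)ᗮ.starProjection.comp_memLp' IsGaussian.memLp_two_id).integrable_norm_pow two_ne_zero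
  rw [← integral_norm_sq_stdGaussian, ← integral_inner_sq_stdGaussian hu]
  rw [integral_congr_ae (ae_of_all _ (norm_sq_eq_inner_sq_add_norm_sq_starProjection hu)),
    integral_add hinner hproj, add_sub_cancel_left]

variable [Fintype ι]

theorem hasLaw_inner_pi_stdGaussian (hu : ‖u‖ = 1) :
    HasLaw (fun z j => inner ℝ u (z j)) (Measure.pi fun _ : ι => gaussianReal 0 1)
      (Measure.pi fun _ : ι => stdGaussian E) :=
  (measurePreserving_pi _ _ fun _ : ι =>
    ⟨by fun_prop, (hasLaw_inner_stdGaussian hu).map_eq⟩).hasLaw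

variable [MeasurableSpace ι] [MeasurableSingletonClass ι]

theorem memLp_bestStep (hI : Measurable I) (u : E) :
    MemLp (bestStep I u) 2 (Measure.pi fun _ : ι => stdGaussian E) := by
  have heval (j : ι) : MemLp (fun z : ι → E => z j) 2 (Measure.pi fun _ : ι => stdGaussian E) :=
    IsGaussian.memLp_two_id.comp_measurePreserving
      (measurePreserving_eval (fun _ : ι => stdGaussian E) j)
  refine (memLp_finsetSum Finset.univ fun j _ => (heval j).norm).mono
    (measurable_bestStep hI u).aestronglyMeasurable (ae_of_all _ fun z => ?_)
  exact (norm_bestStep_le I u z).trans (le_abs_self _)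

/-- The selection only sees the components along `u`, which are independent of the components
orthogonal to `u`: it does not bias the latter. -/
theorem hasLaw_starProjection_bestStep (hI : Measurable I) (u : E) :
    HasLaw (fun z => (ℝ ∙ u)ᗮ.starProjection (bestStep I u z))
      ((stdGaussian E).map (ℝ ∙ u)ᗮ.starProjection) (Measure.pi fun _ : ι => stdGaussian E) := by
  have hproj : Measurable (ℝ ∙ u)ᗮ.starProjection := by fun_prop
  have hrow : Measurable fun (z : ι → E) j => inner ℝ u (z j) := by fun_prop
  refine hasLaw_eval_of_indepFun (I := fun z => I fun j => inner ℝ u (z j))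
    (W := fun i (z : ι → E) => (ℝ ∙ u)ᗮ.starProjection (z i)) (hI.comp hrow)
    (fun i => hproj.comp (measurable_pi_apply i)) (fun i => ?_) fun i => ?_
  · exact ((hproj.measurePreserving _).comp
      (measurePreserving_eval (fun _ : ι => stdGaussian E) i)).hasLaw
  · exact (indepFun_pi_of_indepFun (by fun_prop) hproj
      (indepFun_inner_starProjection_stdGaussian u)).comp hI (measurable_pi_apply i)

variable [Nonempty ι]

theorem integral_bestStep (hI : Measurable I) (hmin : ∀ (v : ι → ℝ) (j : ι), v (I v) ≤ v j)
    (hu : ‖u‖ = 1) :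
    ∫ z, bestStep I u z ∂(Measure.pi fun _ : ι => stdGaussian E) =
      (∫ v, ⨅ j, v j ∂(Measure.pi fun _ : ι => gaussianReal 0 1)) • u := by
  have hint := (memLp_bestStep (E := E) hI u).integrable one_le_two
  have hinner := integral_inner (𝕜 := ℝ) hint u
  have horth := (ℝ ∙ u)ᗮ.starProjection.integral_comp_comm hint
  have hlaw := (hasLaw_inner_pi_stdGaussian (ι := ι) hu).integral_comp
    measurable_iInf_eval.aestronglyMeasurable
  simp only [Function.comp_def, inner_bestStep hmin] at hinner hlaw
  have hzero : (ℝ ∙ u)ᗮ.starProjection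
      (∫ z, bestStep I u z ∂(Measure.pi fun _ : ι => stdGaussian E)) = 0 := by
    rw [← horth, (hasLaw_starProjection_bestStep hI u).integral_eq,
      integral_map (by fun_prop) (by fun_prop),
      ContinuousLinearMap.integral_comp_comm _ (φ := fun x => x) IsGaussian.integrable_id,
      integral_id_stdGaussian, map_zero]
  rw [← (ℝ ∙ u).starProjection_add_starProjection_orthogonal
    (∫ z, bestStep I u z ∂(Measure.pi fun _ : ι => stdGaussian E)), hzero, add_zero,
    Submodule.starProjection_unit_singleton ℝ hu, ← hinner, hlaw]

theorem integral_norm_sq_bestStep (hI : Measurable I)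
    (hmin : ∀ (v : ι → ℝ) (j : ι), v (I v) ≤ v j) (hu : ‖u‖ = 1) :
    ∫ z, ‖bestStep I u z‖ ^ 2 ∂(Measure.pi fun _ : ι => stdGaussian E) =
      ∫ v, (⨅ j, v j) ^ 2 ∂(Measure.pi fun _ : ι => gaussianReal 0 1) +
        (Module.finrank ℝ E - 1) := by
  have hinner := ((memLp_bestStep hI u).const_inner u).integrable_sq
  have hproj := ((ℝ ∙ u)ᗮ.starProjection.comp_memLp' (memLp_bestStep hI u)).integrable_norm_pow
    two_ne_zero
  have hmin_law := (hasLaw_inner_pi_stdGaussian (ι := ι) hu).integral_comp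
    (f := fun v => (⨅ j, v j) ^ 2) (measurable_iInf_eval.pow_const 2).aestronglyMeasurable
  have hproj_law := (hasLaw_starProjection_bestStep hI u).integral_comp
    (f := fun x => ‖x‖ ^ 2) (by fun_prop)
  rw [integral_map (by fun_prop) (by fun_prop),
    integral_norm_sq_starProjection_orthogonal_stdGaussian hu] at hproj_law
  simp only [Function.comp_def] at hproj hmin_law hproj_law
  rw [integral_congr_ae (ae_of_all _ fun z =>
      norm_sq_eq_inner_sq_add_norm_sq_starProjection hu (bestStep I u z)),
    integral_add hinner hproj, hproj_law, ← hmin_law]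
  simp only [inner_bestStep hmin]

end BestStep

section MinNormalLaw

variable {lam : ℕ}

instance isNegInvariant_gaussianReal (v : NNReal) : (gaussianReal 0 v).IsNegInvariant :=
  ⟨by rw [Measure.neg_def, gaussianReal_map_neg, neg_zero]⟩

theorem isOpenPosMeasure_gaussianReal (m : ℝ) {v : NNReal} (hv : v ≠ 0) :
    (gaussianReal m v).IsOpenPosMeasure :=
  (gaussianReal_absolutelyContinuous' m hv).isOpenPosMeasure

theorem integral_sq_gaussianReal (v : NNReal) : ∫ x, x ^ 2 ∂gaussianReal 0 v = v := by
  rw [← variance_fun_id_gaussianReal (μ := 0),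
    variance_of_integral_eq_zero (by fun_prop) integral_id_gaussianReal]

theorem integral_minNormalLaw :
    ∫ x, x ∂minNormalLaw lam = ∫ v, ⨅ i, v i ∂(Measure.pi fun _ : Fin lam => gaussianReal 0 1) :=
  integral_map measurable_iInf_eval.aemeasurable (by fun_prop)

theorem integral_sq_minNormalLaw :
    ∫ x, x ^ 2 ∂minNormalLaw lam =
      ∫ v, (⨅ i, v i) ^ 2 ∂(Measure.pi fun _ : Fin lam => gaussianReal 0 1) :=
  integral_map measurable_iInf_eval.aemeasurable (by fun_prop)

theorem integral_minNormalLaw_neg (hlam : 2 ≤ lam) : ∫ x, x ∂minNormalLaw lam < 0 := by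
  have : Nontrivial (Fin lam) := Fin.nontrivial_iff_two_le.2 hlam
  have := isOpenPosMeasure_gaussianReal 0 one_ne_zero
  rw [integral_minNormalLaw]
  exact (integral_iInf_lt_integral ((memLp_id_gaussianReal' 1 ENNReal.one_ne_top).integrable
    le_rfl)).trans_eq integral_id_gaussianReal

theorem one_le_integral_sq_minNormalLaw (hlam : 2 ≤ lam) : 1 ≤ ∫ x, x ^ 2 ∂minNormalLaw lam := by
  rw [integral_sq_minNormalLaw, ← NNReal.coe_one,
    ← integral_sq_gaussianReal 1]
  exact integral_sq_le_integral_sq_iInf (by rwa [Fintype.card_fin])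
    (memLp_id_gaussianReal' 2 ENNReal.ofNat_ne_top)

theorem one_lt_integral_sq_minNormalLaw (hlam : 3 ≤ lam) : 1 < ∫ x, x ^ 2 ∂minNormalLaw lam := by
  have := isOpenPosMeasure_gaussianReal 0 one_ne_zero
  rw [integral_sq_minNormalLaw, ← NNReal.coe_one,
    ← integral_sq_gaussianReal 1]
  exact integral_sq_lt_integral_sq_iInf (by rwa [Fintype.card_fin])
    (memLp_id_gaussianReal' 2 ENNReal.ofNat_ne_top)

theorem rate_pos {n : ℕ} (hn : 0 < n) {c d : ℝ} (hc0 : 0 < c) (hc1 : c ≤ 1) (hd : 0 < d)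
    (hlam : 2 ≤ lam) (h : c < 1 ∨ 3 ≤ lam) : 0 < rate n lam c d := by
  have hmean : 0 < (∫ x, x ∂minNormalLaw lam) ^ 2 :=
    sq_pos_of_neg (integral_minNormalLaw_neg hlam)
  have hsq : 0 ≤ (∫ x, x ^ 2 ∂minNormalLaw lam) - 1 :=
    sub_nonneg.2 (one_le_integral_sq_minNormalLaw hlam)
  have : 0 ≤ 1 - c := sub_nonneg.2 hc1
  refine mul_pos (by positivity) ?_
  rcases h with hc | hlam3
  · have : 0 < 1 - c := sub_pos.2 hc
    positivity
  · have : 0 < (∫ x, x ^ 2 ∂minNormalLaw lam) - 1 :=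
      sub_pos.2 (one_lt_integral_sq_minNormalLaw hlam3)
    positivity

end MinNormalLaw

section PathInnovation

variable {Ω α ι : Type*} [MeasurableSpace Ω] {P : Measure Ω}

theorem iIndepFun_fiber {β : Type*} [MeasurableSpace β] {W : α → Ω → β}
    (hW : ∀ k, Measurable (W k)) (h : iIndepFun W P) (φ : α → ι) :
    iIndepFun (fun i ω (k : {k // φ k = i}) => W k ω) P := by
  have := h.isProbabilityMeasure
  have (k : α) : IsProbabilityMeasure (P.map (W k)) :=
    Measure.isProbabilityMeasure_map (hW k).aemeasurable
  have hsigma : iIndepFun (fun (q : Σ i, {k // φ k = i}) ω => W q.2 ω) P :=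
    h.precomp (Equiv.sigmaFiberEquiv φ).injective
  have hcurry : (fun ω i (k : {k // φ k = i}) => W k ω) =
      MeasurableEquiv.piCurry (fun i (_ : {k // φ k = i}) => β) ∘ fun ω q => W q.2 ω := rfl
  rw [iIndepFun_iff_map_fun_eq_infinitePi_map (by fun_prop), hcurry,
    ← Measure.map_map (by fun_prop) (by fun_prop),
    hsigma.map_fun_eq_infinitePi_map (by fun_prop),
    Measure.infinitePi_map_piCurry fun i (k : {k // φ k = i}) => P.map (W k)]
  congrm Measure.infinitePi fun i => ?_
  exact ((h.precomp Subtype.val_injective).map_fun_eq_infinitePi_map (by fun_prop)).symm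

variable {E : Type*} [NormedAddCommGroup E] [InnerProductSpace ℝ E]

/-- The sequence driving the cumulative path: the initial path, followed by the best step of each
iteration in the direction `u`. The noise `w` assigns the initial path to `none` and the step of
child `i` in iteration `t` to `some (t, i)`. -/
def pathInnovation (I : (ι → ℝ) → ι) (u : E) (w : Option (ℕ × ι) → E) : ℕ → E
  | 0 => w none
  | t + 1 => bestStep I u fun i => w (some (t, i))

variable [FiniteDimensional ℝ E] [MeasurableSpace E] {I : (ι → ℝ) → ι} {u : E}
  {W : Option (ℕ × ι) → Ω → E}

theorem hasLaw_noise_pi [Fintype ι] (hW : ∀ k, HasLaw (W k) (stdGaussian E) P)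
    (hind : iIndepFun W P) (t : ℕ) :
    HasLaw (fun ω i => W (some (t, i)) ω) (Measure.pi fun _ : ι => stdGaussian E) P :=
  iIndepFun.hasLaw_pi (fun i => hW (some (t, i)))
    (hind.precomp ((Option.some_injective _).comp (Prod.mk_right_injective t)))

variable [BorelSpace E]

theorem ae_injective_inner_noise [Finite ι] (hu : ‖u‖ = 1)
    (hW : ∀ k, HasLaw (W k) (stdGaussian E) P) (hind : iIndepFun W P) :
    ∀ᵐ ω ∂P, ∀ t, Function.Injective fun i => inner ℝ u (W (some (t, i)) ω) := by
  have := Fintype.ofFinite ι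
  have := nullSingletonClass_gaussianReal (μ := 0) one_ne_zero
  refine ae_all_iff.2 fun t => ?_
  have hlaw := (hasLaw_inner_pi_stdGaussian hu).comp (hasLaw_noise_pi hW hind t)
  refine ae_of_ae_map hlaw.aemeasurable ?_
  rw [hlaw.map_eq]
  exact ae_injective_pi (gaussianReal 0 1)

variable [MeasurableSpace ι] [MeasurableSingletonClass ι]

theorem iIndepFun_pathInnovation [Countable ι] (hI : Measurable I) (u : E)
    (hWm : ∀ k, Measurable (W k)) (hind : iIndepFun W P) :
    iIndepFun (fun t ω => pathInnovation I u (W · ω) t) P := by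
  let time (k : Option (ℕ × ι)) : ℕ := k.elim 0 fun q => q.1 + 1
  let innovation : (t : ℕ) → ({k // time k = t} → E) → E
    | 0, w => w ⟨none, rfl⟩
    | t + 1, w => bestStep I u fun i => w ⟨some (t, i), rfl⟩
  have hmeas : ∀ t, Measurable (innovation t)
    | 0 => measurable_pi_apply _
    | t + 1 => (measurable_bestStep hI u).comp (by fun_prop)
  refine ((iIndepFun_fiber hWm hind time).comp innovation hmeas).congr fun t => ?_
  cases t <;> rfl

theorem identDistrib_pathInnovation_succ [Fintype ι] (hI : Measurable I) (u : E)
    (hW : ∀ k, HasLaw (W k) (stdGaussian E) P) (hind : iIndepFun W P) (t : ℕ) :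
    IdentDistrib (fun ω => pathInnovation I u (W · ω) (t + 1)) (bestStep I u) P
      (Measure.pi fun _ => stdGaussian E) := by
  have hlaw := hasLaw_noise_pi hW hind t
  exact IdentDistrib.comp (f := fun ω i => W (some (t, i)) ω) (g := id)
    ⟨hlaw.aemeasurable, aemeasurable_id, by rw [hlaw.map_eq, Measure.map_id]⟩
    (measurable_bestStep hI u)

theorem isInnovationSequence_pathInnovation [Finite ι] (hI : Measurable I) (u : E)
    (hWm : ∀ k, Measurable (W k)) (hW : ∀ k, HasLaw (W k) (stdGaussian E) P)
    (hind : iIndepFun W P) :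
    IsInnovationSequence (fun t ω => pathInnovation I u (W · ω) t) P := by
  have := Fintype.ofFinite ι
  have hident := identDistrib_pathInnovation_succ hI u hW hind
  exact
  { measurable
      | 0 => hWm none
      | t + 1 => (measurable_bestStep hI u).comp (by fun_prop)
    iIndepFun := iIndepFun_pathInnovation hI u hWm hind
    identDistrib t := (hident t).trans (hident 0).symm
    memLp_initial := IsGaussian.memLp_two_id.comp_measurePreserving ⟨hWm none, (hW none).map_eq⟩
    memLp_innovation := (hident 0).memLp_iff.2 (memLp_bestStep hI u) }

end PathInnovation

section StepSize

variable {Ω : Type*} [MeasurableSpace Ω] {P : Measure Ω} {n : ℕ}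

theorem integrable_cesaroMean {Z : ℕ → Ω → ℝ} (hZ : ∀ t, Integrable (Z t) P) (T : ℕ) :
    Integrable (fun ω => cesaroMean (fun t => Z t ω) T) P :=
  (integrable_finsetSum _ fun t _ => hZ t).smul (T : ℝ)⁻¹

theorem tendsto_integral_cesaroMean {Z : ℕ → Ω → ℝ} {l : ℝ} (hZ : ∀ t, Integrable (Z t) P)
    (hlim : Tendsto (fun t => ∫ ω, Z t ω ∂P) atTop (𝓝 l)) :
    Tendsto (fun T => ∫ ω, cesaroMean (fun t => Z t ω) T ∂P) atTop (𝓝 l) := by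
  refine hlim.cesaro_smul.congr fun T => ?_
  simp only [cesaroMean, integral_smul, integral_finsetSum _ fun t _ => hZ t]

theorem stepSizeChange_pos (c d : ℝ) (p : EuclideanSpace ℝ (Fin n)) : 0 < stepSizeChange c d p :=
  Real.exp_pos _

theorem log_stepSizeChange (c d : ℝ) (p : EuclideanSpace ℝ (Fin n)) :
    Real.log (stepSizeChange c d p) = c / (2 * d) * (‖p‖ ^ 2 / n - 1) :=
  Real.log_exp _

namespace IsInnovationSequence

variable [IsProbabilityMeasure P] {y : ℕ → Ω → EuclideanSpace ℝ (Fin n)} {q : ℝ}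

theorem integrable_log_stepSizeChange (hy : IsInnovationSequence y P) (q κ c d : ℝ) (t : ℕ) :
    Integrable (fun ω => Real.log (stepSizeChange c d
      (autoregressive q κ (fun s => y s ω) t))) P := by
  simp only [log_stepSizeChange]
  exact ((((hy.memLp_autoregressive q κ t).integrable_norm_pow two_ne_zero).div_const _).sub
    (integrable_const 1)).const_mul _

theorem ae_tendsto_cesaroMean_log_stepSizeChange (hy : IsInnovationSequence y P) (hq : |q| < 1)
    (κ c d : ℝ) :
    ∀ᵐ ω ∂P, Tendsto (cesaroMean fun t => Real.log (stepSizeChange c d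
      (autoregressive q κ (fun s => y s ω) (t + 1)))) atTop
      (𝓝 (c / (2 * d) *
        (autoregressiveSqNormLimit q κ (∫ ω, y 1 ω ∂P) (∫ ω, ‖y 1 ω‖ ^ 2 ∂P) / n - 1))) := by
  filter_upwards [hy.ae_tendsto_cesaroMean_norm_sq_autoregressive hq κ] with ω hω
  refine (((tendsto_cesaroMean_succ hω).div_const (n : ℝ)).sub
    (tendsto_cesaroMean_const 1) |>.const_mul (c / (2 * d))).congr fun T => ?_
  simp only [log_stepSizeChange, cesaroMean, ← Finset.mul_sum, Finset.sum_sub_distrib,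
    ← Finset.sum_div, smul_eq_mul]
  ring

theorem tendsto_integral_log_stepSizeChange (hy : IsInnovationSequence y P) (hq : |q| < 1)
    (κ c d : ℝ) :
    Tendsto (fun t => ∫ ω, Real.log (stepSizeChange c d
      (autoregressive q κ (fun s => y s ω) t)) ∂P) atTop
      (𝓝 (c / (2 * d) *
        (autoregressiveSqNormLimit q κ (∫ ω, y 1 ω ∂P) (∫ ω, ‖y 1 ω‖ ^ 2 ∂P) / n - 1))) := by
  refine (((hy.tendsto_integral_norm_sq_autoregressive hq κ).div_const (n : ℝ)).sub_const 1
    |>.const_mul (c / (2 * d))).congr fun t => ?_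
  have hint := (hy.memLp_autoregressive q κ t).integrable_norm_pow two_ne_zero
  simp only [log_stepSizeChange, integral_const_mul,
    integral_sub (hint.div_const (n : ℝ)) (integrable_const 1), integral_div, integral_const,
    probReal_univ, one_smul]

end IsInnovationSequence

end StepSize

section Run

variable {n lam : ℕ}

theorem inner_le_inner_of_strictMono_comp_affine {E : Type*} [NormedAddCommGroup E]
    [InnerProductSpace ℝ E] {g : ℝ → ℝ} (hg : StrictMono g) {a : E} {b : ℝ}
    {f : E → ℝ} (hf : ∀ x, f x = g (inner ℝ a x + b)) {x y : E} (h : f x ≤ f y) :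
    inner ℝ (‖a‖⁻¹ • a) x ≤ inner ℝ (‖a‖⁻¹ • a) y := by
  rw [hf, hf, hg.le_iff_le, add_le_add_iff_right] at h
  rw [real_inner_smul_left, real_inner_smul_left]
  gcongr

variable {f : EuclideanSpace ℝ (Fin n) → ℝ} {select : (Fin lam → ℝ) → Fin lam} {c d : ℝ}
  {s₀ : State n} {z : ℕ → Fin lam → EuclideanSpace ℝ (Fin n)} {u : EuclideanSpace ℝ (Fin n)}
  {I : (Fin lam → ℝ) → Fin lam}

theorem selectedStep_eq_bestStep (hf : ∀ x y, f x ≤ f y → inner ℝ u x ≤ inner ℝ u y)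
    (hselect : IsArgmin select) (hI : IsArgmin I) {s : State n} (hs : 0 < s.stepSize)
    {ξ : Fin lam → EuclideanSpace ℝ (Fin n)}
    (hinj : Function.Injective fun i => inner ℝ u (ξ i)) :
    selectedStep f select s ξ = bestStep I u ξ := by
  refine congrArg ξ (hinj (le_antisymm ?_ (hI (fun i => inner ℝ u (ξ i)) _)))
  have hchild := hf _ _ (hselect (fun i => f (s.parent + s.stepSize • ξ i))
    (I fun i => inner ℝ u (ξ i)))
  rw [inner_add_right, inner_add_right, add_le_add_iff_left, real_inner_smul_right,
    real_inner_smul_right] at hchild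
  exact le_of_mul_le_mul_left hchild hs

theorem run_stepSize_pos (hs₀ : 0 < s₀.stepSize) (t : ℕ) :
    0 < (run f select c d s₀ z t).stepSize := by
  induction t with
  | zero => exact hs₀
  | succ t ih => exact mul_pos ih (stepSizeChange_pos c d _)

theorem log_run_stepSize_div (hs₀ : 0 < s₀.stepSize) (t : ℕ) :
    1 / (t : ℝ) * Real.log ((run f select c d s₀ z t).stepSize / s₀.stepSize) =
      cesaroMean (fun s => Real.log (stepSizeChange c d (run f select c d s₀ z (s + 1)).path))
        t := by
  have hlog : Real.log ((run f select c d s₀ z t).stepSize / s₀.stepSize) =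
      ∑ s ∈ Finset.range t,
        Real.log (stepSizeChange c d (run f select c d s₀ z (s + 1)).path) := by
    induction t with
    | zero => rw [run, div_self hs₀.ne', Real.log_one, Finset.sum_range_zero]
    | succ t ih =>
      have hsucc : (run f select c d s₀ z (t + 1)).stepSize = (run f select c d s₀ z t).stepSize *
          stepSizeChange c d (run f select c d s₀ z (t + 1)).path := rfl
      rw [Finset.sum_range_succ, ← ih, hsucc, mul_div_right_comm, Real.log_mul
        (div_pos (run_stepSize_pos hs₀ t) hs₀).ne' (stepSizeChange_pos c d _).ne']
  rw [hlog, one_div, cesaroMean, smul_eq_mul]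

theorem run_path_eq_autoregressive (hf : ∀ x y, f x ≤ f y → inner ℝ u x ≤ inner ℝ u y)
    (hselect : IsArgmin select) (hI : IsArgmin I) (hs₀ : 0 < s₀.stepSize)
    {w : Option (ℕ × Fin lam) → EuclideanSpace ℝ (Fin n)} (hw : s₀.path = w none)
    (hinj : ∀ t, Function.Injective fun i => inner ℝ u (w (some (t, i)))) (t : ℕ) :
    (run f select c d s₀ (fun s i => w (some (s, i))) t).path =
      autoregressive (1 - c) √(c * (2 - c)) (pathInnovation I u w) t := by
  induction t with
  | zero => exact hw
  | succ t ih =>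
    rw [autoregressive, ← ih, run, step,
      selectedStep_eq_bestStep hf hselect hI (run_stepSize_pos hs₀ t) (hinj t)]
    rfl

end Run

section Rate

variable {Ω : Type*} [MeasurableSpace Ω] {P : Measure Ω} {n lam : ℕ} {c d : ℝ}
  {I : (Fin lam → ℝ) → Fin lam} {u : EuclideanSpace ℝ (Fin n)}
  {W : Option (ℕ × Fin lam) → Ω → EuclideanSpace ℝ (Fin n)}

theorem autoregressiveSqNormLimit_eq_rate (hn : n ≠ 0) (hc0 : 0 < c) (hc2 : c < 2)
    (hu : ‖u‖ = 1) :
    c / (2 * d) * (autoregressiveSqNormLimit (1 - c) √(c * (2 - c))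
      ((∫ x, x ∂minNormalLaw lam) • u) (∫ x, x ^ 2 ∂minNormalLaw lam + (n - 1)) / n - 1) =
      rate n lam c d := by
  have hn' : (n : ℝ) ≠ 0 := by exact_mod_cast hn
  have hc2' : 2 - c ≠ 0 := (sub_pos.2 hc2).ne'
  have hvar : 1 - (1 - c) ^ 2 = c * (2 - c) := by ring
  rw [autoregressiveSqNormLimit, rate, hvar, Real.sq_sqrt (by nlinarith),
    div_self (mul_ne_zero hc0.ne' hc2'), sub_sub_cancel, norm_smul, hu, mul_one,
    Real.norm_eq_abs, sq_abs]
  field_simp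
  ring

theorem autoregressiveSqNormLimit_pathInnovation_eq_rate (hn : n ≠ 0) (hc0 : 0 < c)
    (hc2 : c < 2) (hu : ‖u‖ = 1) (hI : Measurable I) (hmin : IsArgmin I)
    (hW : ∀ k, HasLaw (W k) (stdGaussian (EuclideanSpace ℝ (Fin n))) P)
    (hind : iIndepFun W P) :
    c / (2 * d) * (autoregressiveSqNormLimit (1 - c) √(c * (2 - c))
      (∫ ω, pathInnovation I u (W · ω) 1 ∂P) (∫ ω, ‖pathInnovation I u (W · ω) 1‖ ^ 2 ∂P) / n
        - 1) = rate n lam c d := by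
  have : Nonempty (Fin lam) := ⟨I 0⟩
  have hident := identDistrib_pathInnovation_succ hI u hW hind 0
  have hmean : ∫ ω, pathInnovation I u (W · ω) 1 ∂P = (∫ x, x ∂minNormalLaw lam) • u := by
    rw [integral_minNormalLaw, ← integral_bestStep hI hmin hu]
    exact hident.integral_eq
  have hsq : ∫ ω, ‖pathInnovation I u (W · ω) 1‖ ^ 2 ∂P =
      ∫ x, x ^ 2 ∂minNormalLaw lam + (n - 1) := by
    have hbest := integral_norm_sq_bestStep hI hmin hu
    rw [finrank_euclideanSpace_fin] at hbest
    rw [integral_sq_minNormalLaw, ← hbest]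
    exact (hident.comp (measurable_norm.pow_const 2)).integral_eq
  rw [hmean, hsq, autoregressiveSqNormLimit_eq_rate hn hc0 hc2 hu]

theorem exists_log_run_stepSize_div_ae_eq_cesaroMean (hn : n ≠ 0) (hc0 : 0 < c) (hc2 : c < 2)
    (d : ℝ) {f : EuclideanSpace ℝ (Fin n) → ℝ} (hu : ‖u‖ = 1)
    (hf : ∀ x y, f x ≤ f y → inner ℝ u x ≤ inner ℝ u y)
    {select : (Fin lam → ℝ) → Fin lam} (hselect : IsArgmin select)
    (hW : ∀ k, HasLaw (W k) (stdGaussian (EuclideanSpace ℝ (Fin n))) P) (hind : iIndepFun W P)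
    {s₀ : Ω → State n} (hs₀ : ∀ ω, 0 < (s₀ ω).stepSize) (hpath : ∀ ω, (s₀ ω).path = W none ω) :
    ∃ Z : ℕ → Ω → ℝ, (∀ t, Integrable (Z t) P) ∧
      (∀ᵐ ω ∂P, Tendsto (cesaroMean fun t => Z t ω) atTop (𝓝 (rate n lam c d))) ∧
      Tendsto (fun t => ∫ ω, Z t ω ∂P) atTop (𝓝 (rate n lam c d)) ∧
      ∀ᵐ ω ∂P, ∀ t : ℕ, 1 / (t : ℝ) * Real.log ((run f select c d (s₀ ω)
        (fun s i => W (some (s, i)) ω) t).stepSize / (s₀ ω).stepSize) =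
          cesaroMean (fun s => Z s ω) t := by
  have : Nonempty (Fin lam) := ⟨select 0⟩
  have : IsProbabilityMeasure P := (hW none).isProbabilityMeasure
  obtain ⟨I, hI, hmin⟩ := exists_measurable_argmin (Fin lam)
  let W' (k : Option (ℕ × Fin lam)) : Ω → EuclideanSpace ℝ (Fin n) := (hW k).aemeasurable.mk (W k)
  have hae (k) : W' k =ᵐ[P] W k := (hW k).aemeasurable.ae_eq_mk.symm
  have hWm (k) : Measurable (W' k) := (hW k).aemeasurable.measurable_mk
  have hW' (k) : HasLaw (W' k) (stdGaussian _) P := (hW k).congr (hae k)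
  have hind' : iIndepFun W' P := hind.congr fun k => (hae k).symm
  have hy := isInnovationSequence_pathInnovation hI u hWm hW' hind'
  have hlim := autoregressiveSqNormLimit_pathInnovation_eq_rate (d := d) hn hc0 hc2 hu hI hmin hW'
    hind'
  have hq : |1 - c| < 1 := abs_lt.2 ⟨by linarith, by linarith⟩
  refine ⟨fun t ω => Real.log (stepSizeChange c d (autoregressive (1 - c) √(c * (2 - c))
    (pathInnovation I u (W' · ω)) (t + 1))),
    fun t => hy.integrable_log_stepSizeChange _ _ c d (t + 1), ?_, ?_, ?_⟩
  · rw [← hlim]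
    exact hy.ae_tendsto_cesaroMean_log_stepSizeChange hq _ c d
  · rw [← hlim]
    exact (hy.tendsto_integral_log_stepSizeChange hq _ c d).comp (tendsto_add_atTop_nat 1)
  · filter_upwards [ae_injective_inner_noise hu hW hind, ae_all_iff.2 hae] with ω hinj hω t
    simp only [hω, log_run_stepSize_div (hs₀ ω),
      run_path_eq_autoregressive (w := (W · ω)) hf hselect hmin (hs₀ ω) (hpath ω) hinj]

end Rate

end CSAES

end

open CSAES in
theorem mainTheorem1_general
    {Ω : Type*} [MeasurableSpace Ω] (P : Measure Ω)
    {n lam : ℕ} (c d : ℝ) (hc0 : 0 < c) (hc2 : c < 2) (hd : d ≠ 0)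
    (g : ℝ → ℝ) (hg : StrictMono g)
    (a : EuclideanSpace ℝ (Fin n)) (ha : a ≠ 0) (b : ℝ)
    (f : EuclideanSpace ℝ (Fin n) → ℝ) (hf : ∀ x, f x = g (inner ℝ a x + b))
    (select : (Fin lam → ℝ) → Fin lam) (hselect : IsArgmin select)
    (X₀ : Ω → EuclideanSpace ℝ (Fin n))
    (σ₀ : Ω → ℝ) (hσ₀ : ∀ ω, 0 < σ₀ ω)
    (p₀ : Ω → EuclideanSpace ℝ (Fin n))
    (ξ : ℕ → Fin lam → Ω → EuclideanSpace ℝ (Fin n))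
    (hp₀ : HasLaw p₀ (stdGaussian (EuclideanSpace ℝ (Fin n))) P)
    (hξ : ∀ t i, HasLaw (ξ t i) (stdGaussian (EuclideanSpace ℝ (Fin n))) P)
    (hindep : iIndepFun
      (fun k : Option (ℕ × Fin lam) => k.elim p₀ (fun q => ξ q.1 q.2)) P)
    (σ : ℕ → Ω → ℝ)
    (hσ : ∀ t ω, σ t ω = (run f select c d
      { parent := X₀ ω, stepSize := σ₀ ω, path := p₀ ω } (fun s i => ξ s i ω) t).stepSize) :
    (∀ᵐ ω ∂P, Tendsto (fun t : ℕ => 1 / (t : ℝ) * Real.log (σ t ω / σ 0 ω)) atTop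
      (𝓝 (rate n lam c d))) ∧
    (∀ t : ℕ, Integrable (fun ω => 1 / (t : ℝ) * Real.log (σ t ω / σ 0 ω)) P) ∧
    Tendsto (fun t : ℕ => ∫ ω, 1 / (t : ℝ) * Real.log (σ t ω / σ 0 ω) ∂P) atTop
      (𝓝 (rate n lam c d)) ∧
    (0 < d → c ≤ 1 → 2 ≤ lam → (c < 1 ∨ 3 ≤ lam) →
      0 < rate n lam c d ∧ ∀ᵐ ω ∂P, GeometricallyDivergent (fun t => σ t ω)) := by
  have hn : n ≠ 0 := by
    rintro rfl
    exact ha (Subsingleton.elim a 0)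
  have hu : ‖‖a‖⁻¹ • a‖ = 1 := by rw [norm_smul, norm_inv, norm_norm, inv_mul_cancel₀ (by simpa)]
  obtain ⟨Z, h_int, h_ae, h_lim, h_log⟩ := exists_log_run_stepSize_div_ae_eq_cesaroMean
    hn hc0 hc2 d hu (fun _ _ => inner_le_inner_of_strictMono_comp_affine hg hf) hselect
    (Option.forall.2 ⟨hp₀, fun q => hξ q.1 q.2⟩) hindep
    (s₀ := fun ω => { parent := X₀ ω, stepSize := σ₀ ω, path := p₀ ω }) hσ₀ fun _ => rfl
  have hσ_log : ∀ᵐ ω ∂P, ∀ t : ℕ,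
      cesaroMean (fun s => Z s ω) t = 1 / (t : ℝ) * Real.log (σ t ω / σ 0 ω) := by
    filter_upwards [h_log] with ω hω t
    rw [hσ, hσ, ← hω]
    rfl
  have hσ_log_at (t : ℕ) := hσ_log.mono fun ω hω => hω t
  have hσ_ae : ∀ᵐ ω ∂P, Tendsto (fun t : ℕ => 1 / (t : ℝ) * Real.log (σ t ω / σ 0 ω)) atTop
      (𝓝 (rate n lam c d)) := by
    filter_upwards [hσ_log, h_ae] with ω hω hω_lim using hω_lim.congr hω
  refine ⟨hσ_ae, fun t => (integrable_cesaroMean h_int t).congr (hσ_log_at t),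
    (tendsto_integral_cesaroMean h_int h_lim).congr fun t => integral_congr_ae (hσ_log_at t),
    fun hd hc1 hlam hstrict => ?_⟩
  have hpos := rate_pos (Nat.pos_of_ne_zero hn) hc0 hc1 hd hlam hstrict
  exact ⟨hpos, hσ_ae.mono fun _ hω => ⟨_, hpos, hω⟩⟩

/-- The noise consists of `p₀` and all steps `ξ t i`, jointly independent and standard Gaussian in
`ℝⁿ`; `f` is a strictly increasing function of a nonconstant affine function (so `n ≥ 1`). -/
theorem mainTheorem1
    {Ω : Type*} [MeasurableSpace Ω] (P : Measure Ω) [IsProbabilityMeasure P]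
    {n lam : ℕ} (hlam : 1 ≤ lam)
    (c d : ℝ) (hc0 : 0 < c) (hc1 : c ≤ 1) (hd : 0 < d)
    (g : ℝ → ℝ) (hg : StrictMono g)
    (a : EuclideanSpace ℝ (Fin n)) (ha : a ≠ 0) (b : ℝ)
    (f : EuclideanSpace ℝ (Fin n) → ℝ) (hf : ∀ x, f x = g (inner ℝ a x + b))
    (select : (Fin lam → ℝ) → Fin lam) (hselect : CSAES.IsArgmin select)
    (X₀ : Ω → EuclideanSpace ℝ (Fin n))
    (σ₀ : Ω → ℝ) (hσ₀ : ∀ ω, 0 < σ₀ ω)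
    (p₀ : Ω → EuclideanSpace ℝ (Fin n))
    (ξ : ℕ → Fin lam → Ω → EuclideanSpace ℝ (Fin n))
    (hp₀ : HasLaw p₀ (stdGaussian (EuclideanSpace ℝ (Fin n))) P)
    (hξ : ∀ t i, HasLaw (ξ t i) (stdGaussian (EuclideanSpace ℝ (Fin n))) P)
    (hindep : iIndepFun
      (fun k : Option (ℕ × Fin lam) => k.elim p₀ (fun q => ξ q.1 q.2)) P)
    (σ : ℕ → Ω → ℝ)
    (hσ : ∀ t ω, σ t ω = (CSAES.run f select c d
      { parent := X₀ ω, stepSize := σ₀ ω, path := p₀ ω } (fun s i => ξ s i ω) t).stepSize) :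
    -- almost sure convergence
    (∀ᵐ ω ∂P, Tendsto (fun t : ℕ => 1 / (t : ℝ) * Real.log (σ t ω / σ 0 ω)) atTop
      (𝓝 (CSAES.rate n lam c d))) ∧
    -- convergence in expectation
    (∀ t : ℕ, Integrable (fun ω => 1 / (t : ℝ) * Real.log (σ t ω / σ 0 ω)) P) ∧
    Tendsto (fun t : ℕ => ∫ ω, 1 / (t : ℝ) * Real.log (σ t ω / σ 0 ω) ∂P) atTop
      (𝓝 (CSAES.rate n lam c d)) ∧
    -- positivity of the limit, and geometric divergence
    (2 ≤ lam → (c < 1 ∨ 3 ≤ lam) →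
      0 < CSAES.rate n lam c d ∧
      ∀ᵐ ω ∂P, CSAES.GeometricallyDivergent (fun t => σ t ω)) := by
  obtain ⟨h_ae, h_int, h_lim, h_pos⟩ := mainTheorem1_general P c d hc0 (by linarith) hd.ne' g hg a
    ha b f hf select hselect X₀ σ₀ hσ₀ p₀ ξ hp₀ hξ hindep σ hσ
  exact ⟨h_ae, h_int, h_lim, h_pos hd hc1⟩
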